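/- Let $\mathbb K\in\{\mathbb R,\mathbb C\}$ and let $\mathfrak g$ be a Banach Lie algebra over $\mathbb K$ with a continuous bilinear form $\langle\cdot,\cdot\rangle:\mathfrak g\times\mathfrak g\to\mathbb K$ which is non-degenerate (on both sides) and $\mathrm{ad}$-invariant: $\langle[x,y],z\rangle+\langle y,[x,z]\rangle=0$. Put $\iota:\mathfrak g\hookrightarrow\mathfrak g^*$, $\iota(x)=\langle x,\cdot\rangle$. Let $R$ be a classical $R$-matrix on $\mathfrak g$, i.e. a bounded linear operator such that $[x,y]_R=\frac12([Rx,y]+[x,Ry])$ is a Lie bracket, and assume that the dual map $R^*:\mathfrak g^*\to\mathfrak g^*$ satisfies $R^*\iota(\mathfrak g)\subset\iota(\mathfrak g)$. Let $$\mathcal A=\{F\in C^\infty(\mathfrak g,\mathbb K): D_xF\in\iota(\mathfrak g)\ \ \forall x\in\mathfrak g\},\qquad \iota(\nabla_xF)=D_xF,\qquad \{F,G\}_R(x)=\langle x,[\nabla_xF,\nabla_xG]_R\rangle ,$$ and let $\mathcal A_\infty\subset\mathcal A$ be the set of those $F\in\mathcal A$ for which $x\mapsto\nabla_xF$ is smooth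 from $\mathfrak g$ to $\mathfrak g$. A vector field $X_F:\mathfrak g\to\mathfrak g$ is the Hamiltonian vector field $\{\cdot,F\}_R$ of $F\in\mathcal A$ if $D_xK(X_F(x))=\{K,F\}_R(x)$ for all $K\in\mathcal A$, $x\in\mathfrak g$. A function $F\in\mathcal A$ is $\mathrm{ad}_{\mathfrak g}$-invariant if $D_xF([y,x])=0$ for all $x,y\in\mathfrak g$. (0) $\mathfrak g\cong\iota(\mathfrak g)$ is a Banach Lie–Poisson space with respect to $(\mathfrak g,[\cdot,\cdot]_R)$: the coadjoint action $(\alpha,\iota(x))\mapsto\langle x,[\alpha,\cdot]_R\rangle$ preserves $\iota(\mathfrak g)$ and defines a continuous map $\mathfrak g\times\mathfrak g\to\mathfrak g$. On the unital algebra $\mathcal A$ the bracket $\{\cdot,\cdot\}_R$ is bilinear and anti-symmetric and satisfies the Leibniz rule. If the form $\langle\cdot,\cdot\rangle$ is symmetric, then $\mathfrak g$ with the subbundle $\mathfrak g\times\iota(\mathfrak g)$ of $T^*\mathfrak g$ (fibre the Banach space $\mathfrak g$) and the tensor $\pi_x(a,b)=\langle x,[a,b]_R\rangle$ is a generalized Banach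 Poisson manifold (for closed smooth local sections $a,b,c$ of the subbundle, $D(\pi(a,b))$ is a smooth local section and the cyclic sum of $\pi(a,D(\pi(b,c)))$ vanishes), and $\{\cdot,\cdot\}_R$ is a Poisson bracket $\mathcal A_\infty\times\mathcal A_\infty\to\mathcal A_\infty$. (1) If $F,G\in\mathcal A$ are $\mathrm{ad}_{\mathfrak g}$-invariant, then $\{F,G\}_R=0$. (2) If $F\in\mathcal A$ is $\mathrm{ad}_{\mathfrak g}$-invariant, then it has a unique Hamiltonian vector field, namely $$X_F(x)=\tfrac12[R\nabla_xF,x],$$ so that the curves of its flow are exactly the solutions of the Lax equation $\frac{dx}{dt}=\frac12[R\nabla_xF,x]$. (2') If moreover $\mathfrak g=\mathfrak g_+\oplus\mathfrak g_-$ with closed Lie subalgebras $\mathfrak g_\pm$ and $R=p_+-p_-$ is the difference of the projections $p_\pm(x)=x_\pm$, then $X_F(x)=[(\nabla_xF)_+,x]=-[(\nabla_xF)_-,x]$. (3) In the situation of (2'), let $G$ be a Banach Lie group with Lie algebra $\mathfrak g$, and $G_\pm$ Banach Lie subgroups with Lie algebras $\mathfrak g_\pm$ such that $G=G_+G_-$.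 Let $H\in\mathcal A$ be $\mathrm{Ad}_G$-invariant. Then $H$ is $\mathrm{ad}_{\mathfrak g}$-invariant, and for every $x_0\in\mathfrak g$ there are unique smooth curves $g_\pm:\mathbb R\to G_\pm$ with $$\exp(-t\nabla_{x_0}H)=g_+(t)^{-1}g_-(t),\qquad g_\pm(0)=e .$$ If $J\ni0$ is an open interval and $g_\pm:J\to G_\pm$ are smooth curves solving this factorization problem on $J$, then $$x(t)=\mathrm{Ad}_{g_+(t)}x_0=\mathrm{Ad}_{g_-(t)}x_0\qquad(t\in J)$$ is an integral curve of $X_H=\{\cdot,H\}_R$ on $J$ with $x(0)=x_0$; if $H\in\mathcal A_\infty$, it is the only one. -/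

import Mathlib

open scoped ContDiff Manifold

noncomputable section

namespace BanachAKS

/-! ### Banach Lie algebras, `R`-matrices, invariant pairings

A Banach Lie algebra over `𝕜` (`ℝ` or `ℂ`) is a Banach space `𝔤` with a continuous bilinear map
`br` which is a Lie bracket. The bracket is kept explicit because `𝔤` carries two of them. -/

section Algebra

variable {𝕜 𝔤 : Type*} [RCLike 𝕜] [NormedAddCommGroup 𝔤] [NormedSpace 𝕜 𝔤]

/-- A continuous bilinear map is a Lie bracket: it is alternating and satisfies Jacobi. -/
structure IsLieBracket (br : 𝔤 →L[𝕜] 𝔤 →L[𝕜] 𝔤) : Prop where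
  self : ∀ x, br x x = 0
  jacobi : ∀ x y z, br x (br y z) + br y (br z x) + br z (br x y) = 0

/-- The map `[x, y]_R = ½ ([R x, y] + [x, R y])`. -/
def rBracket (br : 𝔤 →L[𝕜] 𝔤 →L[𝕜] 𝔤) (R : 𝔤 →L[𝕜] 𝔤) : 𝔤 →L[𝕜] 𝔤 →L[𝕜] 𝔤 :=
  (2⁻¹ : 𝕜) • (br.comp R + (br.flip.comp R).flip)

theorem rBracket_apply (br : 𝔤 →L[𝕜] 𝔤 →L[𝕜] 𝔤) (R : 𝔤 →L[𝕜] 𝔤) (x y : 𝔤) :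
    rBracket br R x y = (2⁻¹ : 𝕜) • (br (R x) y + br x (R y)) := rfl

/-- A classical `R`-matrix: a bounded operator whose `R`-bracket is a Lie bracket. -/
def IsClassicalRMatrix (br : 𝔤 →L[𝕜] 𝔤 →L[𝕜] 𝔤) (R : 𝔤 →L[𝕜] 𝔤) : Prop :=
  IsLieBracket (rBracket br R)

/-- A continuous bilinear form, non-degenerate on both sides. -/
structure IsDualityPairing {𝔟 : Type*} [NormedAddCommGroup 𝔟] [NormedSpace 𝕜 𝔟]
    (B : 𝔟 →L[𝕜] 𝔤 →L[𝕜] 𝕜) : Prop where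
  left : ∀ x, (∀ y, B x y = 0) → x = 0
  right : ∀ y, (∀ x, B x y = 0) → y = 0

/-- `⟨[x, y], z⟩ + ⟨y, [x, z]⟩ = 0`. -/
def IsInvariantPairing (br : 𝔤 →L[𝕜] 𝔤 →L[𝕜] 𝔤) (B : 𝔤 →L[𝕜] 𝔤 →L[𝕜] 𝕜) : Prop :=
  ∀ x y z, B (br x y) z + B y (br x z) = 0

/-- The dual map `R* : 𝔤* → 𝔤*`, `α ↦ α ∘ R`, preserves `ι(𝔤) = {⟨x, ·⟩ : x ∈ 𝔤}`. -/
def DualPreservesRange (B : 𝔤 →L[𝕜] 𝔤 →L[𝕜] 𝕜) (R : 𝔤 →L[𝕜] 𝔤) : Prop :=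
  ∀ x, ∃ y, (B x).comp R = B y

/-- `𝔟` is a Banach Lie–Poisson space with respect to `(𝔤, br)`, for the duality pairing `B`:
the coadjoint action `ad*_α x = ⟨x, [α, ·]⟩` of `𝔤` preserves `𝔟 ⊂ 𝔤*` and is continuous as a map
`𝔤 × 𝔟 → 𝔟`. -/
def IsBanachLiePoissonSpace {𝔟 : Type*} [NormedAddCommGroup 𝔟] [NormedSpace 𝕜 𝔟]
    (B : 𝔟 →L[𝕜] 𝔤 →L[𝕜] 𝕜) (br : 𝔤 →L[𝕜] 𝔤 →L[𝕜] 𝔤) : Prop :=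
  IsDualityPairing B ∧ IsLieBracket br ∧
    ∃ coad : 𝔤 → 𝔟 → 𝔟, Continuous (fun p : 𝔤 × 𝔟 => coad p.1 p.2) ∧
      ∀ α x, B (coad α x) = (B x).comp (br α)

end Algebra

/-! ### Generalized Poisson structures -/

section Poisson

variable {𝕜 M 𝔽 : Type*} [RCLike 𝕜] [NormedAddCommGroup M] [NormedSpace 𝕜 M]
  [NormedAddCommGroup 𝔽] [NormedSpace 𝕜 𝔽]

/-- `a` is a closed smooth section over `U` of the subbundle `M × κ(𝔽)` of `T*M = M × M*`: the
1-form `x ↦ κ (a x)` has symmetric derivative. -/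
structure IsClosedSectionOn (κ : 𝔽 →L[𝕜] M →L[𝕜] 𝕜) (a : M → 𝔽) (U : Set M) : Prop where
  smooth : ContDiffOn 𝕜 ∞ a U
  closed : ∀ x ∈ U, ∀ v w, κ (fderiv 𝕜 a x v) w = κ (fderiv 𝕜 a x w) v

/-- `(M, M × 𝔽, π)` is a generalized Banach Poisson manifold, where `M` is a Banach space,
`𝔽` is injected by `κ` in the dual `M*` and separates the points of `M`, and `π` is a smooth
field of continuous skew-symmetric bilinear maps on `𝔽`: for closed local sections `a, b, c`,
the differential of `π(a, b)` is a local section, and the Jacobi identity holds. -/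
structure IsGeneralizedBanachPoisson (κ : 𝔽 →L[𝕜] M →L[𝕜] 𝕜) (π : M → 𝔽 →L[𝕜] 𝔽 →L[𝕜] 𝕜) :
    Prop where
  injective : Function.Injective κ
  separates : ∀ v, (∀ a, κ a v = 0) → v = 0
  smooth : ContDiff 𝕜 ∞ π
  skew : ∀ x a b, π x a b = -π x b a
  differential : ∀ U : Set M, IsOpen U → ∀ a b,
    IsClosedSectionOn κ a U → IsClosedSectionOn κ b U →
      ∃ c : M → 𝔽, ContDiffOn 𝕜 ∞ c U ∧
        ∀ x ∈ U, fderiv 𝕜 (fun y => π y (a y) (b y)) x = κ (c x)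
  jacobi : ∀ U : Set M, IsOpen U → ∀ a b c,
    IsClosedSectionOn κ a U → IsClosedSectionOn κ b U → IsClosedSectionOn κ c U →
      ∀ x ∈ U, ∀ p q r : 𝔽,
        fderiv 𝕜 (fun y => π y (b y) (c y)) x = κ p →
        fderiv 𝕜 (fun y => π y (c y) (a y)) x = κ q →
        fderiv 𝕜 (fun y => π y (a y) (b y)) x = κ r →
        π x (a x) p + π x (b x) q + π x (c x) r = 0

/-- `𝒜` is a unital subalgebra of the functions `M → 𝕜`, on which `P` is bilinear, anti-symmetric
and satisfies the Leibniz rule. -/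
structure IsSkewBiderivation (𝒜 : Set (M → 𝕜)) (P : (M → 𝕜) → (M → 𝕜) → M → 𝕜) : Prop where
  const_mem : ∀ c : 𝕜, (fun _ => c) ∈ 𝒜
  add_mem : ∀ F ∈ 𝒜, ∀ G ∈ 𝒜, F + G ∈ 𝒜
  mul_mem : ∀ F ∈ 𝒜, ∀ G ∈ 𝒜, F * G ∈ 𝒜
  add_left : ∀ F ∈ 𝒜, ∀ G ∈ 𝒜, ∀ K ∈ 𝒜, P (F + G) K = P F K + P G K
  smul_left : ∀ c : 𝕜, ∀ F ∈ 𝒜, ∀ G ∈ 𝒜, P (c • F) G = c • P F G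
  skew : ∀ F ∈ 𝒜, ∀ G ∈ 𝒜, P F G = -P G F
  leibniz : ∀ F ∈ 𝒜, ∀ G ∈ 𝒜, ∀ K ∈ 𝒜, P F (G * K) = P F G * K + G * P F K

/-- `P` is a Poisson bracket `𝒜 × 𝒜 → 𝒜` on the unital algebra of functions `𝒜`. -/
structure IsPoissonBracketOn (𝒜 : Set (M → 𝕜)) (P : (M → 𝕜) → (M → 𝕜) → M → 𝕜) : Prop
    extends IsSkewBiderivation 𝒜 P where
  bracket_mem : ∀ F ∈ 𝒜, ∀ G ∈ 𝒜, P F G ∈ 𝒜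
  jacobi : ∀ F ∈ 𝒜, ∀ G ∈ 𝒜, ∀ K ∈ 𝒜, P (P F G) K + P (P G K) F + P (P K F) G = 0

end Poisson

/-! ### Gradients and the bracket `{·, ·}_R` -/

section Gradient

variable {𝕜 𝔤 : Type*} [RCLike 𝕜] [NormedAddCommGroup 𝔤] [NormedSpace 𝕜 𝔤]

/-- The algebra `𝒜` of smooth functions on `𝔤` with all differentials in `ι(𝔤)`. -/
def admissible (B : 𝔤 →L[𝕜] 𝔤 →L[𝕜] 𝕜) : Set (𝔤 → 𝕜) :=
  {F | ContDiff 𝕜 ∞ F ∧ ∀ x, ∃ y, fderiv 𝕜 F x = B y}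

open Classical in
/-- The gradient `∇_x F ∈ 𝔤`, with `⟨∇_x F, ·⟩ = D_x F` (and the value `0` if there is none). -/
def grad (B : 𝔤 →L[𝕜] 𝔤 →L[𝕜] 𝕜) (F : 𝔤 → 𝕜) (x : 𝔤) : 𝔤 :=
  if h : ∃ y, fderiv 𝕜 F x = B y then h.choose else 0

theorem grad_spec {B : 𝔤 →L[𝕜] 𝔤 →L[𝕜] 𝕜} {F : 𝔤 → 𝕜} (hF : F ∈ admissible B) (x : 𝔤) :
    fderiv 𝕜 F x = B (grad B F x) := by
  have h := hF.2 x
  rw [grad, dif_pos h]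
  exact h.choose_spec

/-- The functions in `𝒜` whose gradient is smooth as a map `𝔤 → 𝔤`, i.e. whose differential is a
smooth section of the bundle `𝔤 × ι(𝔤)` with fibre the Banach space `𝔤`. -/
def smoothAdmissible (B : 𝔤 →L[𝕜] 𝔤 →L[𝕜] 𝕜) : Set (𝔤 → 𝕜) :=
  {F | F ∈ admissible B ∧ ContDiff 𝕜 ∞ (grad B F)}

/-- `{F, G}(x) = ⟨x, [∇_x F, ∇_x G]⟩`. -/
def liePoisson (B : 𝔤 →L[𝕜] 𝔤 →L[𝕜] 𝕜) (br : 𝔤 →L[𝕜] 𝔤 →L[𝕜] 𝔤) (F G : 𝔤 → 𝕜) (x : 𝔤) : 𝕜 :=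
  B x (br (grad B F x) (grad B G x))

/-- The tensor `π_x(a, b) = ⟨x, [a, b]⟩` on the bundle `𝔤 × ι(𝔤)`. -/
def liePoissonTensor (B : 𝔤 →L[𝕜] 𝔤 →L[𝕜] 𝕜) (br : 𝔤 →L[𝕜] 𝔤 →L[𝕜] 𝔤) (x : 𝔤) :
    𝔤 →L[𝕜] 𝔤 →L[𝕜] 𝕜 :=
  (ContinuousLinearMap.compL 𝕜 𝔤 𝔤 𝕜 (B x)).comp br

theorem liePoissonTensor_apply (B : 𝔤 →L[𝕜] 𝔤 →L[𝕜] 𝕜) (br : 𝔤 →L[𝕜] 𝔤 →L[𝕜] 𝔤) (x a b : 𝔤) :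
    liePoissonTensor B br x a b = B x (br a b) := rfl

/-- `X` is the Hamiltonian vector field `X_F = {·, F}` of `F` for the bracket of `br`:
`D_x K (X(x)) = {K, F}(x)` for all `K ∈ 𝒜`. -/
def IsHamiltonianVectorField (B : 𝔤 →L[𝕜] 𝔤 →L[𝕜] 𝕜) (br : 𝔤 →L[𝕜] 𝔤 →L[𝕜] 𝔤)
    (F : 𝔤 → 𝕜) (X : 𝔤 → 𝔤) : Prop :=
  ∀ K ∈ admissible B, ∀ x, fderiv 𝕜 K x (X x) = liePoisson B br K F x

/-- `F` is `ad`-invariant: `D_x F ([y, x]) = 0`. -/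
def IsAdInvariantFun (br : 𝔤 →L[𝕜] 𝔤 →L[𝕜] 𝔤) (F : 𝔤 → 𝕜) : Prop :=
  ∀ x y, fderiv 𝕜 F x (br y x) = 0

/-- `𝔤 = 𝔤₊ ⊕ 𝔤₋` as a sum of Banach Lie algebras: complementary closed Lie subalgebras. -/
structure IsLieSplitting (br : 𝔤 →L[𝕜] 𝔤 →L[𝕜] 𝔤) (𝔤p 𝔤m : Submodule 𝕜 𝔤) : Prop where
  isCompl : IsCompl 𝔤p 𝔤m
  isClosed_p : IsClosed (𝔤p : Set 𝔤)
  isClosed_m : IsClosed (𝔤m : Set 𝔤)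
  lie_p : ∀ x ∈ 𝔤p, ∀ y ∈ 𝔤p, br x y ∈ 𝔤p
  lie_m : ∀ x ∈ 𝔤m, ∀ y ∈ 𝔤m, br x y ∈ 𝔤m

/-- The projection `x ↦ x₊` on `𝔤₊` along `𝔤₋`. -/
def IsLieSplitting.projP {br : 𝔤 →L[𝕜] 𝔤 →L[𝕜] 𝔤} {𝔤p 𝔤m : Submodule 𝕜 𝔤}
    (h : IsLieSplitting br 𝔤p 𝔤m) (x : 𝔤) : 𝔤 :=
  𝔤p.projection 𝔤m h.isCompl x

/-- The projection `x ↦ x₋` on `𝔤₋` along `𝔤₊`. -/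
def IsLieSplitting.projM {br : 𝔤 →L[𝕜] 𝔤 →L[𝕜] 𝔤} {𝔤p 𝔤m : Submodule 𝕜 𝔤}
    (h : IsLieSplitting br 𝔤p 𝔤m) (x : 𝔤) : 𝔤 :=
  𝔤m.projection 𝔤p h.isCompl.symm x

end Gradient

/-! ### Banach Lie groups

`G` is a smooth Lie group modelled on a real Banach space `E`; an isomorphism `L` identifies its
tangent space at the identity with the Banach Lie algebra `𝔤`. Tangent spaces at points that are
equal to `1` (such as `g * 1 * g⁻¹`) are identified with the tangent space at `1`. -/

section Group

variable {𝕜 𝔤 : Type*} [RCLike 𝕜] [NormedAddCommGroup 𝔤] [NormedSpace 𝕜 𝔤] [NormedSpace ℝ 𝔤]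
  {E : Type*} [NormedAddCommGroup E] [NormedSpace ℝ E]
  {G : Type*} [TopologicalSpace G] [ChartedSpace E G] [Group G]
  {E' : Type*} [NormedAddCommGroup E'] [NormedSpace ℝ E']
  {K : Type*} [TopologicalSpace K] [ChartedSpace E' K] [Group K]
  {E'' : Type*} [NormedAddCommGroup E''] [NormedSpace ℝ E'']
  {N : Type*} [TopologicalSpace N] [ChartedSpace E'' N] [Group N]

/-- `L` identifies the Lie algebra of `G` (defined by left-invariant vector fields) with
`(𝔤, br)`. -/
def IsLieAlgebraIso (br : 𝔤 →L[𝕜] 𝔤 →L[𝕜] 𝔤) (L : GroupLieAlgebra 𝓘(ℝ, E) G ≃L[ℝ] 𝔤) : Prop :=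
  ∀ v w : GroupLieAlgebra 𝓘(ℝ, E) G, L ⁅v, w⁆ = br (L v) (L w)

/-- The derivative at the identity of a map `f` with `f 1 = 1`, as a map into `𝔤`. -/
def derivAtOne (L : GroupLieAlgebra 𝓘(ℝ, E) G ≃L[ℝ] 𝔤) (f : K → G)
    (v : GroupLieAlgebra 𝓘(ℝ, E') K) : 𝔤 :=
  L (show GroupLieAlgebra 𝓘(ℝ, E) G from mfderiv 𝓘(ℝ, E') 𝓘(ℝ, E) f 1 v)

/-- The adjoint action of `g ∈ G` on `𝔤`: the derivative at `1` of `h ↦ g h g⁻¹`. -/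
def adjoint (L : GroupLieAlgebra 𝓘(ℝ, E) G ≃L[ℝ] 𝔤) (g : G) (x : 𝔤) : 𝔤 :=
  derivAtOne L (fun h : G => g * h * g⁻¹) (L.symm x)

/-- `c(t) = exp(t X)`: `c` is the smooth one-parameter subgroup of `G` with velocity `X` at `0`. -/
structure IsExpCurve (L : GroupLieAlgebra 𝓘(ℝ, E) G ≃L[ℝ] 𝔤) (X : 𝔤) (c : ℝ → G) : Prop where
  smooth : ContMDiff 𝓘(ℝ, ℝ) 𝓘(ℝ, E) ∞ c
  map_add : ∀ s t, c (s + t) = c s * c t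
  velocity : L (show GroupLieAlgebra 𝓘(ℝ, E) G from
    mfderiv 𝓘(ℝ, ℝ) 𝓘(ℝ, E) c 0 (show TangentSpace 𝓘(ℝ, ℝ) (0 : ℝ) from (1 : ℝ))) = X

/-- The injective homomorphism `j : K → G` makes the Banach Lie group `K` a Banach Lie subgroup
of `G` with Lie algebra `𝔨 ⊂ 𝔤`. -/
structure IsBanachLieSubgroup (L : GroupLieAlgebra 𝓘(ℝ, E) G ≃L[ℝ] 𝔤) (j : K →* G)
    (𝔨 : Submodule 𝕜 𝔤) : Prop where
  injective : Function.Injective j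
  smooth : ContMDiff 𝓘(ℝ, E') 𝓘(ℝ, E) ∞ j
  injective_deriv : Function.Injective (derivAtOne (E' := E') L (j : K → G))
  range_deriv : Set.range (derivAtOne (E' := E') L (j : K → G)) = 𝔨

/-- The smooth curves `gp` in `K = G₊` and `gm` in `N = G₋` solve, on the set of times `J`, the
factorization problem `c(t) = g₊(t)⁻¹ g₋(t)`, `g₊(0) = g₋(0) = e`. -/
structure IsFactorization (j : K →* G) (k : N →* G) (c : ℝ → G) (gp : ℝ → K) (gm : ℝ → N)
    (J : Set ℝ) : Prop where
  smooth_p : ContMDiffOn 𝓘(ℝ, ℝ) 𝓘(ℝ, E') ∞ gp J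
  smooth_m : ContMDiffOn 𝓘(ℝ, ℝ) 𝓘(ℝ, E'') ∞ gm J
  zero_p : gp 0 = 1
  zero_m : gm 0 = 1
  factor : ∀ t ∈ J, c t = (j (gp t))⁻¹ * k (gm t)

end Group

end BanachAKS

end

open BanachAKS

/-!
The algebraic part rests on one identity. If `F` is `ad`-invariant then `[x, ∇_x F] = 0`
(`IsAdInvariantFun.br_grad`), so in `{K, F}_R(x) = ½ ⟨x, [R ∇K, ∇F] + [∇K, R ∇F]⟩` the first term
vanishes and invariance of the pairing turns the second into `⟨∇K, ½ [R ∇F, x]⟩`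
(`liePoisson_rBracket_eq`). Involutivity and the Lax form of the Hamiltonian vector field follow.
The coadjoint action of `[·, ·]_R` on `ι(𝔤) ≅ 𝔤` is `-½ ([R α, x] + R* [α, x])`, where `R*` is bounded
on `𝔤` by the closed graph theorem. With it, and with the symmetry of the derivatives of closed
sections, the differential of `π(a, b)` is the explicit section of `fderiv_liePoissonTensor_eq`, and
the Jacobi identity reduces to that of `[·, ·]_R`.

For the group part, `T_1 G` is identified with the model space by the chart at `1`. The bracket is
the antisymmetrized mixed second derivative of the multiplication
(`chartBracket_eq_fderiv_chartMul`), and differentiating `g h = (g h g⁻¹) g` yields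
`d/dt Ad_{γ(t)} x = [γ' γ⁻¹, Ad_{γ(t)} x]` (`HasRightLogDerivAt.hasDerivAt_adjoint`). Hence an
`Ad`-invariant function is `ad`-invariant, and along curves through `1` the pairing is preserved by
`Ad` and the gradient is equivariant. If `exp (-t ∇_{x₀} H) = g₊⁻¹ g₋`, then comparing the logarithmic
derivatives in `g₋ = g₊ exp (-t ∇_{x₀} H)` gives `g₊' g₊⁻¹ - g₋' g₋⁻¹ = ∇_{x(t)} H`, so
`g₊' g₊⁻¹ = (∇_{x(t)} H)₊` and `x(t) = Ad_{g₊(t)} x₀` solves the Lax equation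
(`IsFactorization.hasDerivAt_adjointCLM`).

The factorization exists for all times because `(a, b) ↦ a⁻¹ b` is a covering map `G₊ × G₋ → G`
(`isCoveringMap_factor`): by the inverse function theorem and `𝔤 = 𝔤₊ ⊕ 𝔤₋` it is a local
diffeomorphism at `(1, 1)`, by translation everywhere, it is onto since `G = G₊ G₋`, and its fibres are
the orbits of a discrete group. Curves on `ℝ` therefore lift uniquely, and the lifts are smooth.
-/

namespace BanachAKS

/-! ### The coadjoint action of the `R`-bracket -/

section RMatrix

variable {𝕜 𝔤 : Type*} [RCLike 𝕜] [NormedAddCommGroup 𝔤] [NormedSpace 𝕜 𝔤]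
  {br : 𝔤 →L[𝕜] 𝔤 →L[𝕜] 𝔤} {B : 𝔤 →L[𝕜] 𝔤 →L[𝕜] 𝕜} {R : 𝔤 →L[𝕜] 𝔤}

theorem IsLieBracket.skew (h : IsLieBracket br) (x y : 𝔤) : br x y = -br y x := by
  have h1 := h.self (x + y)
  simp only [map_add, add_apply, h.self, zero_add, add_zero] at h1
  exact eq_neg_of_add_eq_zero_right h1

theorem IsDualityPairing.injective (hB : IsDualityPairing B) : Function.Injective B := by
  intro x y h
  rw [← sub_eq_zero]
  refine hB.left _ fun z => ?_
  simp [h]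

theorem IsInvariantPairing.apply_left (hinv : IsInvariantPairing br B) (x y z : 𝔤) :
    B (br x y) z = -B y (br x z) :=
  eq_neg_of_add_eq_zero_left (hinv x y z)

/-- The operator `R* : 𝔤* → 𝔤*` restricts to a bounded operator on `ι(𝔤) ≅ 𝔤`, by the closed graph
theorem. -/
theorem DualPreservesRange.exists_continuousLinearMap [CompleteSpace 𝔤]
    (hB : IsDualityPairing B) (h : DualPreservesRange B R) :
    ∃ S : 𝔤 →L[𝕜] 𝔤, ∀ x y, B (S x) y = B x (R y) := by
  choose f hf using h
  have hf' : ∀ x y, B (f x) y = B x (R y) := fun x y => (congrArg (fun T => T y) (hf x)).symm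
  let g : 𝔤 →ₗ[𝕜] 𝔤 :=
    { toFun := f
      map_add' := fun x y => hB.injective <| by ext z; simp [hf']
      map_smul' := fun c x => hB.injective <| by ext z; simp [hf'] }
  have hg : Continuous g := by
    refine g.continuous_of_seq_closed_graph fun u x y hu hgu => hB.injective ?_
    ext z
    refine tendsto_nhds_unique (((B.flip z).continuous.tendsto y).comp hgu) ?_
    have h1 := ((B.flip (R z)).continuous.tendsto x).comp hu
    have h2 : B (g x) z = B x (R z) := hf' x z
    rw [h2]
    refine h1.congr fun n => ?_
    exact (hf' (u n) z).symm
  exact ⟨⟨g, hg⟩, hf'⟩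

/-- The coadjoint action of `(𝔤, [·, ·]_R)` on `ι(𝔤) ≅ 𝔤` is
`ad*_α x = -½ ([R α, x] + R* [α, x])`. -/
theorem exists_coadjoint [CompleteSpace 𝔤] (hB : IsDualityPairing B)
    (hinv : IsInvariantPairing br B) (hR : DualPreservesRange B R) :
    ∃ A : 𝔤 →L[𝕜] 𝔤 →L[𝕜] 𝔤, ∀ α x y, B (A α x) y = B x (rBracket br R α y) := by
  obtain ⟨S, hS⟩ := hR.exists_continuousLinearMap hB
  refine ⟨-((2⁻¹ : 𝕜) • (br.comp R + (ContinuousLinearMap.compL 𝕜 𝔤 𝔤 𝔤 S).comp br)), ?_⟩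
  intro α x y
  simp only [rBracket_apply, neg_apply, smul_apply, add_apply, ContinuousLinearMap.comp_apply,
    ContinuousLinearMap.compL_apply, map_neg, map_smul, map_add, hS, hinv.apply_left]
  rw [← neg_add, smul_neg, neg_neg]

theorem isBanachLiePoissonSpace_rBracket [CompleteSpace 𝔤] (hB : IsDualityPairing B)
    (hinv : IsInvariantPairing br B) (hR : IsClassicalRMatrix br R)
    (hRdual : DualPreservesRange B R) : IsBanachLiePoissonSpace B (rBracket br R) := by
  obtain ⟨A, hA⟩ := exists_coadjoint hB hinv hRdual
  exact ⟨hB, hR, fun α x => A α x, A.continuous₂, fun α x => by ext y; exact hA α x y⟩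

end RMatrix

/-! ### Gradients and the Lie–Poisson bracket -/

section Bracket

variable {𝕜 𝔤 : Type*} [RCLike 𝕜] [NormedAddCommGroup 𝔤] [NormedSpace 𝕜 𝔤]
  {br : 𝔤 →L[𝕜] 𝔤 →L[𝕜] 𝔤} {B : 𝔤 →L[𝕜] 𝔤 →L[𝕜] 𝕜} {F G : 𝔤 → 𝕜}

theorem grad_eq (hB : IsDualityPairing B) {x y : 𝔤} (h : fderiv 𝕜 F x = B y) :
    grad B F x = y := by
  have h' : ∃ y, fderiv 𝕜 F x = B y := ⟨y, h⟩
  rw [grad, dif_pos h']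
  exact hB.injective (h'.choose_spec.symm.trans h)

theorem differentiableAt_of_mem_admissible (hF : F ∈ admissible B) (x : 𝔤) :
    DifferentiableAt 𝕜 F x :=
  (hF.1.differentiable (by simp)) x

theorem fderiv_const_eq (c : 𝕜) (x : 𝔤) : fderiv 𝕜 (fun _ => c) x = B 0 := by
  simp

theorem fderiv_add_eq (hF : F ∈ admissible B) (hG : G ∈ admissible B) (x : 𝔤) :
    fderiv 𝕜 (F + G) x = B (grad B F x + grad B G x) := by
  rw [fderiv_add (differentiableAt_of_mem_admissible hF x)
    (differentiableAt_of_mem_admissible hG x), grad_spec hF, grad_spec hG, map_add]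

theorem fderiv_mul_eq (hF : F ∈ admissible B) (hG : G ∈ admissible B) (x : 𝔤) :
    fderiv 𝕜 (F * G) x = B (F x • grad B G x + G x • grad B F x) := by
  rw [fderiv_mul (differentiableAt_of_mem_admissible hF x)
    (differentiableAt_of_mem_admissible hG x), grad_spec hF, grad_spec hG, map_add, map_smul,
    map_smul]

theorem fderiv_const_smul_eq (c : 𝕜) (hF : F ∈ admissible B) (x : 𝔤) :
    fderiv 𝕜 (c • F) x = B (c • grad B F x) := by
  rw [fderiv_const_smul (differentiableAt_of_mem_admissible hF x), grad_spec hF, map_smul]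

theorem const_mem_admissible (c : 𝕜) : (fun _ => c) ∈ admissible B :=
  ⟨contDiff_const, fun x => ⟨0, fderiv_const_eq c x⟩⟩

theorem add_mem_admissible (hF : F ∈ admissible B) (hG : G ∈ admissible B) :
    F + G ∈ admissible B :=
  ⟨hF.1.add hG.1, fun x => ⟨_, fderiv_add_eq hF hG x⟩⟩

theorem mul_mem_admissible (hF : F ∈ admissible B) (hG : G ∈ admissible B) :
    F * G ∈ admissible B :=
  ⟨hF.1.mul hG.1, fun x => ⟨_, fderiv_mul_eq hF hG x⟩⟩

theorem pairing_mem_admissible (y : 𝔤) : (fun z => B y z) ∈ admissible B :=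
  ⟨(B y).contDiff, fun x => ⟨y, (B y).fderiv⟩⟩

theorem isSkewBiderivation_admissible (hB : IsDualityPairing B) (hbr : IsLieBracket br) :
    IsSkewBiderivation (admissible B) (liePoisson B br) where
  const_mem := const_mem_admissible
  add_mem _ hF _ hG := add_mem_admissible hF hG
  mul_mem _ hF _ hG := mul_mem_admissible hF hG
  add_left F hF G hG K _ := by
    ext x
    simp [liePoisson, grad_eq hB (fderiv_add_eq hF hG x)]
  smul_left c F hF G _ := by
    ext x
    simp [liePoisson, grad_eq hB (fderiv_const_smul_eq c hF x)]
  skew F _ G _ := by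
    ext x
    simp [liePoisson, hbr.skew (grad B F x)]
  leibniz F _ G hG K hK := by
    ext x
    simp only [liePoisson, grad_eq hB (fderiv_mul_eq hG hK x), map_add, map_smul, smul_eq_mul,
      Pi.add_apply, Pi.mul_apply]
    ring

theorem IsSkewBiderivation.mono {𝕜 𝔤 : Type*} [RCLike 𝕜] {𝒜 𝒜' : Set (𝔤 → 𝕜)} {P : (𝔤 → 𝕜) → (𝔤 → 𝕜) → 𝔤 → 𝕜}
    (h : IsSkewBiderivation 𝒜 P) (hsub : 𝒜' ⊆ 𝒜) (hc : ∀ c : 𝕜, (fun _ => c) ∈ 𝒜')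
    (ha : ∀ F ∈ 𝒜', ∀ G ∈ 𝒜', F + G ∈ 𝒜') (hm : ∀ F ∈ 𝒜', ∀ G ∈ 𝒜', F * G ∈ 𝒜') :
    IsSkewBiderivation 𝒜' P where
  const_mem := hc
  add_mem := ha
  mul_mem := hm
  add_left F hF G hG K hK := h.add_left F (hsub hF) G (hsub hG) K (hsub hK)
  smul_left c F hF G hG := h.smul_left c F (hsub hF) G (hsub hG)
  skew F hF G hG := h.skew F (hsub hF) G (hsub hG)
  leibniz F hF G hG K hK := h.leibniz F (hsub hF) G (hsub hG) K (hsub hK)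

/-! ### The generalized Poisson structure for a symmetric pairing -/

/-- The differential of `π(a, b)` is the local section
`[a, b] - Da (ad*_b x) + Db (ad*_a x)`. Closedness moves the direction of differentiation of `a` and
`b` to the other slot of the pairing. -/
theorem fderiv_liePoissonTensor_eq (hsymm : ∀ x y, B x y = B y x) (hbr : IsLieBracket br)
    {A : 𝔤 →L[𝕜] 𝔤 →L[𝕜] 𝔤} (hA : ∀ α x y, B (A α x) y = B x (br α y))
    {U : Set 𝔤} (hU : IsOpen U) {a b : 𝔤 → 𝔤} (ha : IsClosedSectionOn B a U)
    (hb : IsClosedSectionOn B b U) {x : 𝔤} (hx : x ∈ U) :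
    fderiv 𝕜 (fun y => liePoissonTensor B br y (a y) (b y)) x =
      B (br (a x) (b x) - fderiv 𝕜 a x (A (b x) x) + fderiv 𝕜 b x (A (a x) x)) := by
  have hda := ((ha.smooth.contDiffAt (hU.mem_nhds hx)).differentiableAt (by simp)).hasFDerivAt
  have hdb := ((hb.smooth.contDiffAt (hU.mem_nhds hx)).differentiableAt (by simp)).hasFDerivAt
  have h1 : HasFDerivAt (fun y => br (a y) (b y)) _ x := br.hasFDerivAt_of_bilinear hda hdb
  have h2 : HasFDerivAt (fun y => B y (br (a y) (b y))) _ x :=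
    B.hasFDerivAt_of_bilinear (hasFDerivAt_id x) h1
  have h3 := h2.fderiv
  change fderiv 𝕜 (fun y => B y (br (a y) (b y))) x = _
  rw [h3]
  ext v
  have e1 : B x (br (a x) (fderiv 𝕜 b x v)) = B (fderiv 𝕜 b x (A (a x) x)) v := by
    rw [← hA, hsymm, hb.closed x hx]
  have e2 : B x (br (fderiv 𝕜 a x v) (b x)) = -B (fderiv 𝕜 a x (A (b x) x)) v := by
    rw [hbr.skew, map_neg, ← hA, hsymm, ha.closed x hx]
  simp [e1, e2, hsymm v]
  ring

theorem isGeneralizedBanachPoisson_liePoissonTensor (hB : IsDualityPairing B)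
    (hsymm : ∀ x y, B x y = B y x) (hbr : IsLieBracket br)
    {A : 𝔤 →L[𝕜] 𝔤 →L[𝕜] 𝔤} (hA : ∀ α x y, B (A α x) y = B x (br α y)) :
    IsGeneralizedBanachPoisson B (liePoissonTensor B br) where
  injective := hB.injective
  separates := hB.right
  smooth := by
    unfold liePoissonTensor
    fun_prop
  skew x a b := by simp [liePoissonTensor_apply, hbr.skew a b]
  differential U hU a b ha hb := by
    refine ⟨fun x => br (a x) (b x) - fderiv 𝕜 a x (A (b x) x) + fderiv 𝕜 b x (A (a x) x), ?_,
      fun x hx => fderiv_liePoissonTensor_eq hsymm hbr hA hU ha hb hx⟩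
    have ha' := ha.smooth.fderiv_of_isOpen hU (m := ∞) le_rfl
    have hb' := hb.smooth.fderiv_of_isOpen hU (m := ∞) le_rfl
    have hsa := ha.smooth
    have hsb := hb.smooth
    have hAs (c : 𝔤 → 𝔤) (hc : ContDiffOn 𝕜 ∞ c U) : ContDiffOn 𝕜 ∞ (fun x => A (c x) x) U :=
      (A.contDiff.comp_contDiffOn hc).clm_apply contDiffOn_id
    exact (((br.contDiff.comp_contDiffOn hsa).clm_apply hsb).sub
      (ha'.clm_apply (hAs b hsb))).add (hb'.clm_apply (hAs a hsa))
  jacobi U hU a b c ha hb hc x hx p q r hp hq hr := by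
    rw [fderiv_liePoissonTensor_eq hsymm hbr hA hU hb hc hx] at hp
    rw [fderiv_liePoissonTensor_eq hsymm hbr hA hU hc ha hx] at hq
    rw [fderiv_liePoissonTensor_eq hsymm hbr hA hU ha hb hx] at hr
    rw [← hB.injective hp, ← hB.injective hq, ← hB.injective hr]
    simp only [liePoissonTensor_apply, ← hA _ x]
    have hj := congrArg (B x) (hbr.jacobi (a x) (b x) (c x))
    simp only [map_add, map_zero, ← hA _ x] at hj
    have e1 := ha.closed x hx (A (b x) x) (A (c x) x)
    have e2 := hb.closed x hx (A (c x) x) (A (a x) x)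
    have e3 := hc.closed x hx (A (a x) x) (A (b x) x)
    simp only [map_add, map_sub, hsymm _ (fderiv 𝕜 _ _ _)]
    linear_combination hj - e1 - e2 - e3

theorem isClosedSectionOn_grad (hF : F ∈ smoothAdmissible B) :
    IsClosedSectionOn B (grad B F) Set.univ where
  smooth := hF.2.contDiffOn
  closed x _ v w := by
    have hs : IsSymmSndFDerivAt 𝕜 F x :=
      hF.1.1.contDiffAt.isSymmSndFDerivAt (by simp [ENat.LEInfty.out])
    have he : fderiv 𝕜 F = fun y => B (grad B F y) := funext fun y => grad_spec hF.1 y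
    have hd : HasFDerivAt (fun y => B (grad B F y)) (B.comp (fderiv 𝕜 (grad B F) x)) x :=
      B.hasFDerivAt.comp x ((hF.2.differentiable (by simp)) x).hasFDerivAt
    have h1 := hs v w
    rw [he, hd.fderiv] at h1
    exact h1

theorem mem_smoothAdmissible (hB : IsDualityPairing B) {c : 𝔤 → 𝔤} (hF : ContDiff 𝕜 ∞ F)
    (h : ∀ x, fderiv 𝕜 F x = B (c x)) (hc : ContDiff 𝕜 ∞ c) : F ∈ smoothAdmissible B := by
  refine ⟨⟨hF, fun x => ⟨_, h x⟩⟩, ?_⟩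
  rwa [show grad B F = c from funext fun x => grad_eq hB (h x)]

theorem contDiff_liePoisson (hF : F ∈ smoothAdmissible B) (hG : G ∈ smoothAdmissible B) :
    ContDiff 𝕜 ∞ (liePoisson B br F G) :=
  B.contDiff.clm_apply ((br.contDiff.comp hF.2).clm_apply hG.2)

theorem isPoissonBracketOn_smoothAdmissible (hB : IsDualityPairing B)
    (hsymm : ∀ x y, B x y = B y x) (hbr : IsLieBracket br)
    {A : 𝔤 →L[𝕜] 𝔤 →L[𝕜] 𝔤} (hA : ∀ α x y, B (A α x) y = B x (br α y)) :
    IsPoissonBracketOn (smoothAdmissible B) (liePoisson B br) := by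
  have hP := isGeneralizedBanachPoisson_liePoissonTensor hB hsymm hbr hA
  have hmem : ∀ F ∈ smoothAdmissible B, ∀ G ∈ smoothAdmissible B,
      liePoisson B br F G ∈ smoothAdmissible B := by
    intro F hF G hG
    obtain ⟨c, hc, hd⟩ := hP.differential Set.univ isOpen_univ _ _
      (isClosedSectionOn_grad hF) (isClosedSectionOn_grad hG)
    exact mem_smoothAdmissible hB (contDiff_liePoisson hF hG) (fun x => hd x trivial)
      (contDiffOn_univ.1 hc)
  refine ⟨(isSkewBiderivation_admissible hB hbr).mono (fun _ h => h.1) ?_ ?_ ?_, hmem, ?_⟩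
  · exact fun c => mem_smoothAdmissible hB contDiff_const (fderiv_const_eq c) contDiff_const
  · exact fun F hF G hG => mem_smoothAdmissible hB (hF.1.1.add hG.1.1)
      (fderiv_add_eq hF.1 hG.1) (hF.2.add hG.2)
  · exact fun F hF G hG => mem_smoothAdmissible hB (hF.1.1.mul hG.1.1)
      (fderiv_mul_eq hF.1 hG.1) ((hF.1.1.smul hG.2).add (hG.1.1.smul hF.2))
  · intro F hF G hG K hK
    ext x
    have hj := hP.jacobi Set.univ isOpen_univ _ _ _ (isClosedSectionOn_grad hF)
      (isClosedSectionOn_grad hG) (isClosedSectionOn_grad hK) x trivial _ _ _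
      (grad_spec (hmem G hG K hK).1 x) (grad_spec (hmem K hK F hF).1 x)
      (grad_spec (hmem F hF G hG).1 x)
    simp only [liePoissonTensor_apply] at hj
    simp only [Pi.add_apply, Pi.zero_apply, liePoisson.eq_1 B br (liePoisson B br _ _),
      hbr.skew (grad B (liePoisson B br _ _) _), map_neg]
    linear_combination -hj

end Bracket

/-! ### Invariant functions and Lax equations -/

section Lax

variable {𝕜 𝔤 : Type*} [RCLike 𝕜] [NormedAddCommGroup 𝔤] [NormedSpace 𝕜 𝔤]
  {br : 𝔤 →L[𝕜] 𝔤 →L[𝕜] 𝔤} {B : 𝔤 →L[𝕜] 𝔤 →L[𝕜] 𝕜} {R : 𝔤 →L[𝕜] 𝔤} {F G : 𝔤 → 𝕜}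

/-- The gradient of an `ad`-invariant function at `x` commutes with `x`. -/
theorem IsAdInvariantFun.br_grad (h : IsAdInvariantFun br F) (hbr : IsLieBracket br)
    (hB : IsDualityPairing B) (hinv : IsInvariantPairing br B) (hF : F ∈ admissible B) (x : 𝔤) :
    br x (grad B F x) = 0 := by
  refine hB.left _ fun y => ?_
  have h1 := h x y
  rw [grad_spec hF x, hbr.skew, map_neg] at h1
  rw [hinv.apply_left, h1]

theorem liePoisson_rBracket_eq (hbr : IsLieBracket br) (hinv : IsInvariantPairing br B)
    (hB : IsDualityPairing B) (hF : F ∈ admissible B) (h : IsAdInvariantFun br F) (K : 𝔤 → 𝕜)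
    (x : 𝔤) :
    liePoisson B (rBracket br R) K F x =
      B (grad B K x) ((2⁻¹ : 𝕜) • br (R (grad B F x)) x) := by
  have e1 : B x (br (R (grad B K x)) (grad B F x)) = 0 := by
    have := hinv.apply_left (R (grad B K x)) x (grad B F x)
    rw [hbr.skew, map_neg, neg_apply, hinv.apply_left,
      h.br_grad hbr hB hinv hF] at this
    simpa using this.symm
  have e2 : B x (br (grad B K x) (R (grad B F x))) = B (grad B K x) (br (R (grad B F x)) x) := by
    rw [hbr.skew (R (grad B F x)) x, map_neg, ← hinv.apply_left, hbr.skew x, map_neg,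
      neg_apply, hinv.apply_left, neg_neg]
  simp only [liePoisson, rBracket_apply, map_smul, map_add, e1, e2, zero_add]

theorem liePoisson_rBracket_eq_zero (hbr : IsLieBracket br) (hinv : IsInvariantPairing br B)
    (hB : IsDualityPairing B) (hF : F ∈ admissible B) (hG : G ∈ admissible B)
    (hFi : IsAdInvariantFun br F) (hGi : IsAdInvariantFun br G) :
    liePoisson B (rBracket br R) F G = 0 := by
  ext x
  rw [liePoisson_rBracket_eq hbr hinv hB hG hGi, map_smul, hbr.skew, map_neg, ← hinv.apply_left,
    hFi.br_grad hbr hB hinv hF]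
  simp

theorem isHamiltonianVectorField_iff (hbr : IsLieBracket br) (hinv : IsInvariantPairing br B)
    (hB : IsDualityPairing B) (hF : F ∈ admissible B) (hFi : IsAdInvariantFun br F)
    (X : 𝔤 → 𝔤) :
    IsHamiltonianVectorField B (rBracket br R) F X ↔
      ∀ x, X x = (2⁻¹ : 𝕜) • br (R (grad B F x)) x := by
  constructor
  · intro h x
    rw [← sub_eq_zero]
    refine hB.right _ fun y => ?_
    -- the linear functions `⟨y, ·⟩` detect the value of the vector field
    have h1 := h _ (pairing_mem_admissible y) x
    rw [liePoisson_rBracket_eq hbr hinv hB hF hFi, grad_spec (pairing_mem_admissible y),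
      grad_eq hB (B y).fderiv] at h1
    rw [map_sub, h1, sub_self]
  · intro h K hK x
    rw [liePoisson_rBracket_eq hbr hinv hB hF hFi, grad_spec hK, h]

/-- For `R = p₊ - p₋` one has `½ R y = y₊ - ½ y = ½ y - y₋`, so for `y` commuting with `x` the
vector `½ [R y, x]` is both `[y₊, x]` and `-[y₋, x]`. -/
theorem half_br_splitting (hbr : IsLieBracket br) {𝔤p 𝔤m : Submodule 𝕜 𝔤}
    (hs : IsLieSplitting br 𝔤p 𝔤m) (hR : ∀ x, R x = hs.projP x - hs.projM x) {x y : 𝔤}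
    (hxy : br x y = 0) :
    (2⁻¹ : 𝕜) • br (R y) x = br (hs.projP y) x ∧
      (2⁻¹ : 𝕜) • br (R y) x = -br (hs.projM y) x := by
  have hsum : hs.projP y + hs.projM y = y :=
    Submodule.projection_add_projection_eq_self hs.isCompl y
  have h0 : br (hs.projP y) x + br (hs.projM y) x = 0 := by
    rw [← add_apply, ← map_add, hsum, hbr.skew, hxy, neg_zero]
  have h1 : br (hs.projM y) x = -br (hs.projP y) x := eq_neg_of_add_eq_zero_right h0
  have h2 : (2⁻¹ : 𝕜) • br (R y) x = br (hs.projP y) x := by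
    rw [hR, map_sub, sub_apply, h1, sub_neg_eq_add, ← two_smul 𝕜,
      smul_smul, inv_mul_cancel₀ two_ne_zero, one_smul]
  exact ⟨h2, by rw [h2, h1, neg_neg]⟩

end Lax


/-! ### Lie groups in the chart at the identity -/

section Chart

open Filter Topology

variable {E : Type*} [NormedAddCommGroup E] [NormedSpace ℝ E]
  {G : Type*} [TopologicalSpace G] [ChartedSpace E G] [Group G]
  {E' : Type*} [NormedAddCommGroup E'] [NormedSpace ℝ E']
  {K : Type*} [TopologicalSpace K] [ChartedSpace E' K] [Group K]
  {E'' : Type*} [NormedAddCommGroup E''] [NormedSpace ℝ E'']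
  {N : Type*} [TopologicalSpace N] [ChartedSpace E'' N] [Group N]

variable (E G) in
/-- The preferred chart of `G` at the identity; it identifies `T_1 G` with `E`. -/
noncomputable def unitChart : PartialEquiv G E := extChartAt 𝓘(ℝ, E) (1 : G)

/-- A map between Lie groups, read in the charts at the identities. -/
noncomputable def chartRep (f : K → G) (x : E') : E := unitChart E G (f ((unitChart E' K).symm x))

/-- The multiplication of `G`, read in the chart at the identity. -/
noncomputable def chartMul (E G : Type*) [NormedAddCommGroup E] [NormedSpace ℝ E] [TopologicalSpace G]
    [ChartedSpace E G] [Group G] (p : E × E) : E :=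
  unitChart E G ((unitChart E G).symm p.1 * (unitChart E G).symm p.2)

theorem unitChart_symm_one : (unitChart E G).symm (unitChart E G 1) = 1 :=
  extChartAt_to_inv (I := 𝓘(ℝ, E)) (1 : G)

theorem eventually_unitChart_symm_apply :
    ∀ᶠ g in 𝓝 (1 : G), (unitChart E G).symm (unitChart E G g) = g := by
  filter_upwards [extChartAt_source_mem_nhds (I := 𝓘(ℝ, E)) (1 : G)] with g hg
  exact (unitChart E G).left_inv hg

theorem eventually_unitChart_apply_symm :
    ∀ᶠ x in 𝓝 (unitChart E G 1), unitChart E G ((unitChart E G).symm x) = x := by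
  filter_upwards [extChartAt_target_mem_nhds (I := 𝓘(ℝ, E)) (1 : G)] with x hx
  exact (unitChart E G).right_inv hx

theorem continuousAt_unitChart : ContinuousAt (unitChart E G) 1 :=
  continuousAt_extChartAt (I := 𝓘(ℝ, E)) (1 : G)

theorem tendsto_unitChart_symm :
    Tendsto (unitChart E G).symm (𝓝 (unitChart E G 1)) (𝓝 1) := by
  have h := continuousAt_extChartAt_symm (I := 𝓘(ℝ, E)) (1 : G)
  rw [ContinuousAt, extChartAt_to_inv] at h
  exact h

theorem chartRep_unitChart {f : K → G} {g : K}
    (hg : (unitChart E' K).symm (unitChart E' K g) = g) :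
    chartRep (E := E) (E' := E') f (unitChart E' K g) = unitChart E G (f g) := by
  rw [chartRep, hg]

theorem chartRep_one {f : K → G} (hf : f 1 = 1) :
    chartRep (E := E) (E' := E') f (unitChart E' K 1) = unitChart E G 1 := by
  rw [chartRep_unitChart unitChart_symm_one, hf]

theorem hasFDerivAt_chartRep {f : K → G} (hf1 : f 1 = 1)
    (hf : MDifferentiableAt 𝓘(ℝ, E') 𝓘(ℝ, E) f 1) :
    HasFDerivAt (chartRep (E := E) (E' := E') f)
      (show E' →L[ℝ] E from mfderiv 𝓘(ℝ, E') 𝓘(ℝ, E) f 1) (unitChart E' K 1) := by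
  have h := hf.hasMFDerivAt.2
  rw [writtenInExtChartAt, hf1, ModelWithCorners.range_eq_univ] at h
  exact hasFDerivWithinAt_univ.1 h

theorem hasFDerivAt_comp_unitChart_symm {f : K → E}
    (hf : MDifferentiableAt 𝓘(ℝ, E') 𝓘(ℝ, E) f 1) :
    HasFDerivAt (fun x => f ((unitChart E' K).symm x))
      (show E' →L[ℝ] E from mfderiv 𝓘(ℝ, E') 𝓘(ℝ, E) f 1) (unitChart E' K 1) := by
  have h := hf.hasMFDerivAt.2
  rw [ModelWithCorners.range_eq_univ] at h
  exact hasFDerivWithinAt_univ.1 h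

variable [LieGroup 𝓘(ℝ, E) ∞ G] [LieGroup 𝓘(ℝ, E') ∞ K] [LieGroup 𝓘(ℝ, E'') ∞ N]

theorem contMDiffAt_unitChart_symm :
    ContMDiffAt 𝓘(ℝ, E) 𝓘(ℝ, E) ∞ (unitChart E G).symm (unitChart E G 1) :=
  (contMDiffOn_extChartAt_symm (I := 𝓘(ℝ, E)) (n := ∞) (1 : G)).contMDiffAt
    (extChartAt_target_mem_nhds (I := 𝓘(ℝ, E)) (1 : G))

theorem contDiffAt_chartMul :
    ContDiffAt ℝ ∞ (chartMul E G) (unitChart E G 1, unitChart E G 1) := by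
  rw [← contMDiffAt_iff_contDiffAt]
  have h1 : ContMDiffAt 𝓘(ℝ, E × E) 𝓘(ℝ, E) ∞ (fun p : E × E => (unitChart E G).symm p.1)
      (unitChart E G 1, unitChart E G 1) :=
    contMDiffAt_unitChart_symm.comp (unitChart E G 1, unitChart E G 1)
      contDiffAt_fst.contMDiffAt
  have h2 : ContMDiffAt 𝓘(ℝ, E × E) 𝓘(ℝ, E) ∞ (fun p : E × E => (unitChart E G).symm p.2)
      (unitChart E G 1, unitChart E G 1) :=
    contMDiffAt_unitChart_symm.comp (unitChart E G 1, unitChart E G 1)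
      contDiffAt_snd.contMDiffAt
  have h3 : ContMDiffAt 𝓘(ℝ, E) 𝓘(ℝ, E) ∞ (unitChart E G)
      ((unitChart E G).symm (unitChart E G 1) * (unitChart E G).symm (unitChart E G 1)) := by
    rw [unitChart_symm_one, mul_one]
    exact contMDiffAt_extChartAt
  exact ContMDiffAt.comp (unitChart E G 1, unitChart E G 1) h3 (h1.mul h2)

theorem eventually_differentiableAt_chartMul :
    ∀ᶠ p in 𝓝 (unitChart E G 1, unitChart E G 1), DifferentiableAt ℝ (chartMul E G) p := by
  have h : ContDiffAt ℝ 1 (chartMul E G) (unitChart E G 1, unitChart E G 1) :=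
    contDiffAt_chartMul.of_le ENat.LEInfty.out
  filter_upwards [h.eventually (by simp)] with p hp
  exact hp.differentiableAt (by simp)

theorem fderiv_chartMul_inr :
    (fderiv ℝ (chartMul E G) (unitChart E G 1, unitChart E G 1)).comp
      (ContinuousLinearMap.inr ℝ E E) = ContinuousLinearMap.id ℝ E := by
  have h := contDiffAt_chartMul (E := E) (G := G).differentiableAt (by simp)
  have h1 := HasFDerivAt.comp (f := fun x => (unitChart E G 1, x)) (unitChart E G 1)
    h.hasFDerivAt (hasFDerivAt_prodMk_right _ _)
  refine h1.unique ((hasFDerivAt_id _).congr_of_eventuallyEq ?_)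
  filter_upwards [eventually_unitChart_apply_symm (E := E) (G := G)] with x hx
  simp [chartMul, unitChart_symm_one, hx]

theorem fderiv_chartMul_inl :
    (fderiv ℝ (chartMul E G) (unitChart E G 1, unitChart E G 1)).comp
      (ContinuousLinearMap.inl ℝ E E) = ContinuousLinearMap.id ℝ E := by
  have h := contDiffAt_chartMul (E := E) (G := G).differentiableAt (by simp)
  have h1 := HasFDerivAt.comp (f := fun x => (x, unitChart E G 1)) (unitChart E G 1)
    h.hasFDerivAt (hasFDerivAt_prodMk_left _ _)
  refine h1.unique ((hasFDerivAt_id _).congr_of_eventuallyEq ?_)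
  filter_upwards [eventually_unitChart_apply_symm (E := E) (G := G)] with x hx
  simp [chartMul, unitChart_symm_one, hx]

theorem fderiv_chartMul_apply (v w : E) :
    fderiv ℝ (chartMul E G) (unitChart E G 1, unitChart E G 1) (v, w) = v + w := by
  have h1 := DFunLike.congr_fun (fderiv_chartMul_inl (E := E) (G := G)) v
  have h2 := DFunLike.congr_fun (fderiv_chartMul_inr (E := E) (G := G)) w
  simp only [ContinuousLinearMap.comp_apply, ContinuousLinearMap.inl_apply,
    ContinuousLinearMap.inr_apply, ContinuousLinearMap.id_apply] at h1 h2
  rw [show ((v, w) : E × E) = (v, 0) + (0, w) by simp, map_add, h1, h2]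

theorem hasFDerivAt_fderiv_chartMul :
    HasFDerivAt (fderiv ℝ (chartMul E G))
      (fderiv ℝ (fderiv ℝ (chartMul E G)) (unitChart E G 1, unitChart E G 1))
      (unitChart E G 1, unitChart E G 1) := by
  have h := contDiffAt_chartMul (E := E) (G := G).fderiv_right (m := ∞) le_rfl
  exact (h.differentiableAt (by simp)).hasFDerivAt

/-- The bracket of the Lie algebra `T_1 G` of `G`, transported to the model space `E`. -/
noncomputable def chartBracket (E G : Type*) [NormedAddCommGroup E] [NormedSpace ℝ E]
    [TopologicalSpace G] [ChartedSpace E G] [Group G] (v w : E) : E :=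
  Bracket.bracket (L := GroupLieAlgebra 𝓘(ℝ, E) G) (M := GroupLieAlgebra 𝓘(ℝ, E) G) v w

/-- The bracket of the Lie algebra of `G` is the antisymmetrization of the mixed second derivative
of the multiplication, since in the chart the left-invariant field of `v` is `x ↦ D₂μ(x, 1) v`. -/
theorem chartBracket_eq_fderiv_chartMul (v w : E) : chartBracket E G v w =
    fderiv ℝ (fderiv ℝ (chartMul E G)) (unitChart E G 1, unitChart E G 1) (v, 0) (0, w) -
    fderiv ℝ (fderiv ℝ (chartMul E G)) (unitChart E G 1, unitChart E G 1) (w, 0) (0, v) := by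
  set e := unitChart E G 1 with he
  have h0 (u : E) : fderiv ℝ (chartMul E G) (e, e) (0, u) = u := by
    rw [he, fderiv_chartMul_apply, zero_add]
  have key : ∀ u : E, (VectorField.mpullbackWithin 𝓘(ℝ, E) 𝓘(ℝ, E) (unitChart E G).symm
      (mulInvariantVectorField (I := 𝓘(ℝ, E)) (G := G) u) Set.univ : E → E)
      =ᶠ[𝓝 e] fun x => fderiv ℝ (chartMul E G) (x, e) (0, u) := by
    intro u
    have hc : ContinuousAt (fun x : E => (x, e)) e := by fun_prop
    filter_upwards [extChartAt_target_mem_nhds (I := 𝓘(ℝ, E)) (1 : G),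
      hc.eventually eventually_differentiableAt_chartMul] with x hx hd
    have hinv : (mfderivWithin 𝓘(ℝ, E) 𝓘(ℝ, E) (unitChart E G).symm Set.univ x).inverse =
        mfderiv 𝓘(ℝ, E) 𝓘(ℝ, E) (unitChart E G) ((unitChart E G).symm x) := by
      have h1 := mfderiv_extChartAt_comp_mfderivWithin_extChartAt_symm (I := 𝓘(ℝ, E)) hx
      have h2 := mfderivWithin_extChartAt_symm_comp_mfderiv_extChartAt (I := 𝓘(ℝ, E)) hx
      rw [ModelWithCorners.range_eq_univ] at h1 h2
      exact ContinuousLinearMap.inverse_eq h2 h1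
    rw [VectorField.mpullbackWithin_apply, hinv]
    set g : G := (unitChart E G).symm x with hg
    have hgs : g ∈ (chartAt E (1 : G)).source := by
      rw [← extChartAt_source 𝓘(ℝ, E)]
      exact (unitChart E G).map_target hx
    have hm : MDifferentiableAt 𝓘(ℝ, E) 𝓘(ℝ, E) (fun h : G => g * h) 1 :=
      (contMDiff_mul_left (I := 𝓘(ℝ, E)) (n := ∞) (a := g)).contMDiffAt.mdifferentiableAt (by simp)
    have hφ : MDifferentiableAt 𝓘(ℝ, E) 𝓘(ℝ, E) (unitChart E G) (g * 1) := by
      rw [mul_one]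
      exact mdifferentiableAt_extChartAt hgs
    have hcomp := mfderiv_comp (1 : G) hφ hm
    have hd1 := hasFDerivAt_comp_unitChart_symm (hφ.comp (1 : G) hm)
    have hd2 : HasFDerivAt (fun y => chartMul E G (x, y)) _ e :=
      hd.hasFDerivAt.comp e (hasFDerivAt_prodMk_right x e)
    have hu := DFunLike.congr_fun (hd1.unique hd2) u
    simp only [ContinuousLinearMap.comp_apply, ContinuousLinearMap.inr_apply] at hu
    rw [← hu]
    have hmul : ∀ y : G, y = g → (show E →L[ℝ] E from
        mfderiv 𝓘(ℝ, E) 𝓘(ℝ, E) (unitChart E G) y) =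
        (show E →L[ℝ] E from mfderiv 𝓘(ℝ, E) 𝓘(ℝ, E) (unitChart E G) g) := by
      rintro y rfl; rfl
    have h3 := DFunLike.congr_fun (hmul (g * 1) (mul_one g))
      (mfderiv 𝓘(ℝ, E) 𝓘(ℝ, E) (fun h : G => g * h) 1 u)
    refine Eq.trans ?_ (Eq.trans h3.symm ?_)
    · rfl
    · exact (DFunLike.congr_fun hcomp u).symm
  have hderiv : ∀ u : E, HasFDerivAt (fun x => fderiv ℝ (chartMul E G) (x, e) (0, u))
      (((fderiv ℝ (fderiv ℝ (chartMul E G)) (e, e)).comp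
        (ContinuousLinearMap.inl ℝ E E)).flip (0, u)) e := by
    intro u
    have h1 := HasFDerivAt.comp (f := fun x => (x, e)) e
      (hasFDerivAt_fderiv_chartMul (E := E) (G := G)) (hasFDerivAt_prodMk_left e e)
    have h2 := h1.clm_apply (hasFDerivAt_const ((0 : E), u) e)
    rw [ContinuousLinearMap.comp_zero, zero_add] at h2
    exact h2
  have hbr : chartBracket E G v w =
      VectorField.lieBracket ℝ (fun x => fderiv ℝ (chartMul E G) (x, e) (0, v))
        (fun x => fderiv ℝ (chartMul E G) (x, e) (0, w)) e := by
    rw [← (key v).lieBracket_vectorField_eq (key w)]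
    change VectorField.mlieBracket 𝓘(ℝ, E) (mulInvariantVectorField (I := 𝓘(ℝ, E)) (G := G) v)
      (mulInvariantVectorField (I := 𝓘(ℝ, E)) (G := G) w) 1 = _
    rw [VectorField.mlieBracket, VectorField.mlieBracketWithin_apply,
      mfderiv_extChartAt_self]
    simp only [ModelWithCorners.range_eq_univ, Set.preimage_univ, Set.inter_univ]
    have hid : (ContinuousLinearMap.id ℝ E).inverse = ContinuousLinearMap.id ℝ E :=
      ContinuousLinearMap.inverse_id
    refine (DFunLike.congr_fun hid _).trans ?_
    exact congrFun VectorField.lieBracketWithin_univ _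
  refine hbr.trans ?_
  rw [VectorField.lieBracket, (hderiv v).fderiv, (hderiv w).fderiv, h0, h0]
  rfl

end Chart


/-! ### The adjoint action and right logarithmic derivatives -/

section Adjoint

open Filter Topology

variable {E : Type*} [NormedAddCommGroup E] [NormedSpace ℝ E]
  {G : Type*} [TopologicalSpace G] [ChartedSpace E G] [Group G]
  {E' : Type*} [NormedAddCommGroup E'] [NormedSpace ℝ E']
  {K : Type*} [TopologicalSpace K] [ChartedSpace E' K] [Group K]

variable (E) in
/-- The adjoint action of `g` on `T_1 G`, identified with the model space `E`. -/
noncomputable def chartAd (g : G) : E →L[ℝ] E :=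
  mfderiv 𝓘(ℝ, E) 𝓘(ℝ, E) (fun h : G => g * h * g⁻¹) 1

/-- The curve `γ` has right logarithmic derivative `γ'(t) γ(t)⁻¹ = ξ` at `t`, with `T_1 G`
identified with the model space `E`. -/
structure HasRightLogDerivAt (γ : ℝ → G) ξ (t : ℝ) : Prop where
  continuousAt : ContinuousAt γ t
  hasDerivAt : HasDerivAt (fun s => unitChart E G (γ s * (γ t)⁻¹)) ξ t

theorem HasRightLogDerivAt.unique {γ : ℝ → G} {ξ η : E} {t : ℝ}
    (h : HasRightLogDerivAt γ ξ t) (h' : HasRightLogDerivAt γ η t) : ξ = η :=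
  h.hasDerivAt.unique h'.hasDerivAt

theorem HasRightLogDerivAt.congr {γ γ' : ℝ → G} {ξ : E} {t : ℝ}
    (h : HasRightLogDerivAt γ ξ t) (he : γ' =ᶠ[𝓝 t] γ) : HasRightLogDerivAt γ' ξ t where
  continuousAt := h.continuousAt.congr he.symm
  hasDerivAt := by
    refine h.hasDerivAt.congr_of_eventuallyEq ?_
    filter_upwards [he] with s hs
    rw [hs, he.self_of_nhds]

theorem HasRightLogDerivAt.comp_monoidHom [LieGroup 𝓘(ℝ, E') ∞ K] {γ : ℝ → K} {ξ : E'} {t : ℝ}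
    (h : HasRightLogDerivAt γ ξ t) (f : K →* G) (hf : ContMDiff 𝓘(ℝ, E') 𝓘(ℝ, E) ∞ f) :
    HasRightLogDerivAt (fun s => f (γ s))
      ((show E' →L[ℝ] E from mfderiv 𝓘(ℝ, E') 𝓘(ℝ, E) f 1) ξ) t where
  continuousAt := hf.continuous.continuousAt.comp h.continuousAt
  hasDerivAt := by
    have : IsTopologicalGroup K := topologicalGroup_of_lieGroup 𝓘(ℝ, E') ∞
    have h1 := hasFDerivAt_chartRep (f := f) (map_one f)
      (hf.contMDiffAt.mdifferentiableAt (by simp))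
    have h0 : unitChart E' K 1 = unitChart E' K (γ t * (γ t)⁻¹) := by simp
    rw [h0] at h1
    refine (h1.comp_hasDerivAt t h.hasDerivAt).congr_of_eventuallyEq ?_
    have h2 : Tendsto (fun s => γ s * (γ t)⁻¹) (𝓝 t) (𝓝 1) := by
      simpa using h.continuousAt.tendsto.mul_const (γ t)⁻¹
    filter_upwards [h2.eventually (eventually_unitChart_symm_apply (E := E'))] with s hs
    simp only [Function.comp_apply]
    rw [chartRep_unitChart hs, map_mul, map_inv]

variable [LieGroup 𝓘(ℝ, E) ∞ G]

theorem tendsto_conj {G : Type*} [TopologicalSpace G] [Group G] [IsTopologicalGroup G] (g : G) :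
    Tendsto (fun h : G => g * h * g⁻¹) (𝓝 1) (𝓝 1) := by
  have h : Continuous (fun h : G => g * h * g⁻¹) := by fun_prop
  simpa using h.tendsto 1

theorem mdifferentiableAt_conj (g h : G) :
    MDifferentiableAt 𝓘(ℝ, E) 𝓘(ℝ, E) (fun h : G => g * h * g⁻¹) h :=
  ((contMDiff_mul_right (I := 𝓘(ℝ, E)) (n := ∞) (a := g⁻¹)).comp
    (contMDiff_mul_left (I := 𝓘(ℝ, E)) (n := ∞) (a := g))).contMDiffAt.mdifferentiableAt (by simp)

theorem hasFDerivAt_chartRep_conj (g : G) :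
    HasFDerivAt (chartRep (E := E) (E' := E) (fun h : G => g * h * g⁻¹)) (chartAd E g)
      (unitChart E G 1) :=
  hasFDerivAt_chartRep (by simp) (mdifferentiableAt_conj g 1)

theorem chartAd_mul (g h : G) : chartAd E (g * h) = (chartAd E g).comp (chartAd E h) := by
  have : IsTopologicalGroup G := topologicalGroup_of_lieGroup 𝓘(ℝ, E) ∞
  have h1 := hasFDerivAt_chartRep_conj (E := E) g
  rw [← chartRep_one (E := E) (E' := E) (f := fun k : G => h * k * h⁻¹) (by simp)] at h1
  have h2 := h1.comp (unitChart E G 1) (hasFDerivAt_chartRep_conj h)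
  refine (hasFDerivAt_chartRep_conj (g * h)).unique (h2.congr_of_eventuallyEq ?_)
  have h3 := (tendsto_conj h).comp (tendsto_unitChart_symm (E := E) (G := G))
  filter_upwards [h3.eventually (eventually_unitChart_symm_apply (E := E))] with x hx
  simp only [Function.comp_apply] at hx
  simp only [chartRep, Function.comp_apply, hx]
  congr 1
  group

theorem chartAd_one : chartAd E (1 : G) = ContinuousLinearMap.id ℝ E := by
  refine (hasFDerivAt_chartRep_conj (1 : G)).unique ((hasFDerivAt_id _).congr_of_eventuallyEq ?_)
  filter_upwards [eventually_unitChart_apply_symm (E := E) (G := G)] with x hx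
  simp [chartRep, hx]

theorem HasRightLogDerivAt.mul {γ₁ γ₂ : ℝ → G} {ξ₁ ξ₂ : E} {t : ℝ}
    (h₁ : HasRightLogDerivAt γ₁ ξ₁ t) (h₂ : HasRightLogDerivAt γ₂ ξ₂ t) :
    HasRightLogDerivAt (fun s => γ₁ s * γ₂ s) (ξ₁ + chartAd E (γ₁ t) ξ₂) t := by
  have : IsTopologicalGroup G := topologicalGroup_of_lieGroup 𝓘(ℝ, E) ∞
  refine ⟨h₁.continuousAt.mul h₂.continuousAt, ?_⟩
  have e₁ : unitChart E G 1 = unitChart E G (γ₁ t * (γ₁ t)⁻¹) := by simp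
  have e₂ : unitChart E G 1 = unitChart E G (γ₂ t * (γ₂ t)⁻¹) := by simp
  have hA := hasFDerivAt_chartRep_conj (E := E) (γ₁ t)
  rw [e₂] at hA
  have hA' := hA.comp_hasDerivAt t h₂.hasDerivAt
  have hm := (contDiffAt_chartMul (E := E) (G := G).differentiableAt (by simp)).hasFDerivAt
  have hp := h₁.hasDerivAt.prodMk hA'
  have he : (unitChart E G 1, unitChart E G 1) = (unitChart E G (γ₁ t * (γ₁ t)⁻¹),
      (chartRep (E := E) (E' := E) (fun h : G => γ₁ t * h * (γ₁ t)⁻¹) ∘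
        fun s => unitChart E G (γ₂ s * (γ₂ t)⁻¹)) t) := by
    rw [← e₁, Function.comp_apply, ← e₂, chartRep_one (by simp)]
  have hd := fderiv_chartMul_apply (E := E) (G := G) ξ₁ (chartAd E (γ₁ t) ξ₂)
  rw [he] at hm
  have hc := hm.comp_hasDerivAt t hp
  rw [← he, hd] at hc
  refine hc.congr_of_eventuallyEq ?_
  have l₁ : Tendsto (fun s => γ₁ s * (γ₁ t)⁻¹) (𝓝 t) (𝓝 1) := by
    simpa using h₁.continuousAt.tendsto.mul_const (γ₁ t)⁻¹
  have l₂ : Tendsto (fun s => γ₂ s * (γ₂ t)⁻¹) (𝓝 t) (𝓝 1) := by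
    simpa using h₂.continuousAt.tendsto.mul_const (γ₂ t)⁻¹
  have l₃ := (tendsto_conj (γ₁ t)).comp l₂
  filter_upwards [l₁.eventually (eventually_unitChart_symm_apply (E := E)),
    l₂.eventually (eventually_unitChart_symm_apply (E := E)),
    l₃.eventually (eventually_unitChart_symm_apply (E := E))] with s s₁ s₂ s₃
  simp only [Function.comp_apply] at s₃
  simp only [Function.comp_apply, chartMul, chartRep, s₁, s₂, s₃]
  congr 1
  group

theorem ContMDiffAt.exists_hasRightLogDerivAt {γ : ℝ → G} {t : ℝ}
    (h : ContMDiffAt 𝓘(ℝ, ℝ) 𝓘(ℝ, E) ∞ γ t) : ∃ ξ : E, HasRightLogDerivAt γ ξ t := by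
  have h1 : ContMDiffAt 𝓘(ℝ, ℝ) 𝓘(ℝ, E) ∞ (fun s => γ s * (γ t)⁻¹) t := h.mul contMDiffAt_const
  have h2 : ContMDiffAt 𝓘(ℝ, E) 𝓘(ℝ, E) ∞ (unitChart E G) (γ t * (γ t)⁻¹) := by
    rw [mul_inv_cancel]
    exact contMDiffAt_extChartAt
  have h3 := (contMDiffAt_iff_contDiffAt.1 (h2.comp t h1)).differentiableAt (by simp)
  exact ⟨_, h.continuousAt, h3.hasDerivAt⟩

/-- In the chart, `Ad_g` is determined by `g h = (g h g⁻¹) g`: differentiating at `h = 1` gives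
`D₁μ(1, g) ∘ Ad_g = D₂μ(g, 1)`. -/
theorem eventually_fderiv_chartMul_comp_chartAd :
    ∀ᶠ g in 𝓝 (1 : G),
      ((fderiv ℝ (chartMul E G) (unitChart E G 1, unitChart E G g)).comp
        (ContinuousLinearMap.inl ℝ E E)).comp (chartAd E g) =
      (fderiv ℝ (chartMul E G) (unitChart E G g, unitChart E G 1)).comp
        (ContinuousLinearMap.inr ℝ E E) := by
  have : IsTopologicalGroup G := topologicalGroup_of_lieGroup 𝓘(ℝ, E) ∞
  have l₁ : Tendsto (fun g => (unitChart E G 1, unitChart E G g)) (𝓝 (1 : G))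
      (𝓝 (unitChart E G 1, unitChart E G 1)) :=
    tendsto_const_nhds.prodMk_nhds continuousAt_unitChart
  have l₂ : Tendsto (fun g => (unitChart E G g, unitChart E G 1)) (𝓝 (1 : G))
      (𝓝 (unitChart E G 1, unitChart E G 1)) :=
    Tendsto.prodMk_nhds continuousAt_unitChart tendsto_const_nhds
  filter_upwards [l₁.eventually eventually_differentiableAt_chartMul,
    l₂.eventually eventually_differentiableAt_chartMul,
    eventually_unitChart_symm_apply (E := E)] with g d₁ d₂ hg
  have h1 := HasFDerivAt.comp (f := fun x => (x, unitChart E G g)) (unitChart E G 1)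
    d₁.hasFDerivAt (hasFDerivAt_prodMk_left _ _)
  have h2 := HasFDerivAt.comp (f := fun x => (unitChart E G g, x)) (unitChart E G 1)
    d₂.hasFDerivAt (hasFDerivAt_prodMk_right _ _)
  have hA := hasFDerivAt_chartRep_conj (E := E) g
  have h0 := chartRep_one (E := E) (E' := E) (f := fun k : G => g * k * g⁻¹) (by simp)
  rw [← h0] at h1
  have h4 := (h1.comp (unitChart E G 1) hA).unique (h2.congr_of_eventuallyEq ?_)
  · rwa [h0] at h4
  have h3 := (tendsto_conj g).comp (tendsto_unitChart_symm (E := E) (G := G))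
  filter_upwards [h3.eventually (eventually_unitChart_symm_apply (E := E))] with x hx
  simp only [Function.comp_apply] at hx
  simp [chartMul, chartRep, hx, hg]

/-- The derivative of `Ad` along a curve through `1` with velocity `ξ` is `ad_ξ`. -/
theorem hasDerivAt_chartAd_of_eq_one [CompleteSpace E] {δ : ℝ → G} {t : ℝ}
    {ξ : E} (hc : Tendsto δ (𝓝 t) (𝓝 1)) (h1 : δ t = 1)
    (hδ : HasDerivAt (fun s => unitChart E G (δ s)) ξ t) (w : E) :
    HasDerivAt (fun s => chartAd E (δ s) w) (chartBracket E G ξ w) t := by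
  set D := fderiv ℝ (fderiv ℝ (chartMul E G)) (unitChart E G 1, unitChart E G 1) with hD
  have hD' : HasFDerivAt (fderiv ℝ (chartMul E G)) D (unitChart E G 1, unitChart E G 1) :=
    hasFDerivAt_fderiv_chartMul
  -- the two partial derivatives along the curve
  set P : ℝ → E →L[ℝ] E := fun s => (fderiv ℝ (chartMul E G)
    (unitChart E G 1, unitChart E G (δ s))).comp (ContinuousLinearMap.inl ℝ E E) with hP
  set Q : ℝ → E →L[ℝ] E := fun s => (fderiv ℝ (chartMul E G)
    (unitChart E G (δ s), unitChart E G 1)).comp (ContinuousLinearMap.inr ℝ E E) with hQ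
  have hPt : P t = 1 := by
    simp only [hP, h1]
    exact fderiv_chartMul_inl
  have hQt : Q t = 1 := by
    simp only [hQ, h1]
    exact fderiv_chartMul_inr
  have hP' : HasDerivAt P ((D (0, ξ)).comp (ContinuousLinearMap.inl ℝ E E)) t := by
    have e1 : HasDerivAt (fun s => (unitChart E G 1, unitChart E G (δ s))) ((0 : E), ξ) t :=
      (hasDerivAt_const t _).prodMk hδ
    have e2 := HasFDerivAt.comp_hasDerivAt_of_eq t hD' e1 (by rw [h1])
    have e3 := e2.clm_comp (hasDerivAt_const t (ContinuousLinearMap.inl ℝ E E))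
    rw [ContinuousLinearMap.comp_zero, add_zero] at e3
    exact e3
  have hQ' : HasDerivAt Q ((D (ξ, 0)).comp (ContinuousLinearMap.inr ℝ E E)) t := by
    have e1 : HasDerivAt (fun s => (unitChart E G (δ s), unitChart E G 1)) (ξ, (0 : E)) t :=
      hδ.prodMk (hasDerivAt_const t _)
    have e2 := HasFDerivAt.comp_hasDerivAt_of_eq t hD' e1 (by rw [h1])
    have e3 := e2.clm_comp (hasDerivAt_const t (ContinuousLinearMap.inr ℝ E E))
    rw [ContinuousLinearMap.comp_zero, add_zero] at e3
    exact e3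
  have hI := HasFDerivAt.comp_hasDerivAt_of_eq t
    (hasFDerivAt_ringInverse (𝕜 := ℝ) (1 : (E →L[ℝ] E)ˣ)) hP' (by simp [hPt])
  have hAd : (fun s => chartAd E (δ s)) =ᶠ[𝓝 t] fun s => (Ring.inverse (P s)) * Q s := by
    have hu : ∀ᶠ s in 𝓝 t, IsUnit (P s) := by
      refine hP'.continuousAt.eventually_mem (s := {x | IsUnit x}) ?_
      rw [hPt]
      exact Units.nhds 1
    filter_upwards [hc.eventually (eventually_fderiv_chartMul_comp_chartAd (E := E)), hu] with s hs hus
    have hs' : P s * chartAd E (δ s) = Q s := hs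
    rw [← hs', ← mul_assoc, Ring.inverse_mul_cancel _ hus, one_mul]
  have hfin := ((hI.mul hQ').congr_of_eventuallyEq hAd).clm_apply (hasDerivAt_const t w)
  have hsymm : D (0, ξ) (w, 0) = D (w, 0) (0, ξ) := by
    have hs : IsSymmSndFDerivAt ℝ (chartMul E G) (unitChart E G 1, unitChart E G 1) :=
      (contDiffAt_chartMul (E := E) (G := G)).isSymmSndFDerivAt (by simp [ENat.LEInfty.out])
    exact hs _ _
  refine hfin.congr_deriv ?_
  rw [chartBracket_eq_fderiv_chartMul, ← hD]
  simp [hPt, hQt, hsymm, neg_add_eq_sub]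

end Adjoint


/-! ### The adjoint action on the Banach Lie algebra -/

section AdjointAction

open Filter Topology

variable {𝕜 𝔤 : Type*} [RCLike 𝕜] [NormedAddCommGroup 𝔤] [NormedSpace 𝕜 𝔤] [NormedSpace ℝ 𝔤]
  {E : Type*} [NormedAddCommGroup E] [NormedSpace ℝ E]
  {G : Type*} [TopologicalSpace G] [ChartedSpace E G] [Group G] [LieGroup 𝓘(ℝ, E) ∞ G]
  {E' : Type*} [NormedAddCommGroup E'] [NormedSpace ℝ E']
  {K : Type*} [TopologicalSpace K] [ChartedSpace E' K] [Group K] [LieGroup 𝓘(ℝ, E') ∞ K]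
  {br : 𝔤 →L[𝕜] 𝔤 →L[𝕜] 𝔤} (L : GroupLieAlgebra 𝓘(ℝ, E) G ≃L[ℝ] 𝔤)

/-- The identification of the Lie algebra of `G` with `𝔤`, read on the model space `E`. -/
def modelEquiv : E ≃L[ℝ] 𝔤 := L

/-- The adjoint action of `g` as a bounded operator on `𝔤`. -/
noncomputable def adjointCLM (g : G) : 𝔤 →L[ℝ] 𝔤 :=
  ((modelEquiv L : E →L[ℝ] 𝔤).comp (chartAd E g)).comp ((modelEquiv L).symm : 𝔤 →L[ℝ] E)

omit [LieGroup 𝓘(ℝ, E) ∞ G] in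
theorem adjointCLM_apply (g : G) (x : 𝔤) :
    adjointCLM L g x = modelEquiv L (chartAd E g ((modelEquiv L).symm x)) := rfl

omit [LieGroup 𝓘(ℝ, E) ∞ G] in
theorem adjoint_eq_adjointCLM (g : G) (x : 𝔤) : adjoint L g x = adjointCLM L g x := rfl

theorem adjointCLM_mul (g h : G) (x : 𝔤) :
    adjointCLM L (g * h) x = adjointCLM L g (adjointCLM L h x) := by
  simp [adjointCLM_apply, chartAd_mul]

theorem adjointCLM_one (x : 𝔤) : adjointCLM L (1 : G) x = x := by
  simp [adjointCLM_apply, chartAd_one]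

theorem adjointCLM_surjective (g : G) : Function.Surjective (adjointCLM L g) := fun x =>
  ⟨adjointCLM L g⁻¹ x, by rw [← adjointCLM_mul, mul_inv_cancel, adjointCLM_one]⟩

omit [LieGroup 𝓘(ℝ, E) ∞ G] in
variable {L} in
theorem IsLieAlgebraIso.modelEquiv_chartBracket (hL : IsLieAlgebraIso br L) (v w : E) :
    modelEquiv L (chartBracket E G v w) = br (modelEquiv L v) (modelEquiv L w) :=
  hL v w

variable {L} in
/-- Along a curve `γ` in `G` with right logarithmic derivative `ξ`,
`d/dt Ad_γ(t) x = [ξ, Ad_γ(t) x]`. -/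
theorem HasRightLogDerivAt.hasDerivAt_adjoint [CompleteSpace E] (hL : IsLieAlgebraIso br L)
    {γ : ℝ → G} {ξ : E} {t : ℝ} (h : HasRightLogDerivAt γ ξ t) (x : 𝔤) :
    HasDerivAt (fun s => adjointCLM L (γ s) x)
      (br (modelEquiv L ξ) (adjointCLM L (γ t) x)) t := by
  have : IsTopologicalGroup G := topologicalGroup_of_lieGroup 𝓘(ℝ, E) ∞
  have l₁ : Tendsto (fun s => γ s * (γ t)⁻¹) (𝓝 t) (𝓝 1) := by
    simpa using h.continuousAt.tendsto.mul_const (γ t)⁻¹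
  have h1 := hasDerivAt_chartAd_of_eq_one l₁ (by simp) h.hasDerivAt
    (chartAd E (γ t) ((modelEquiv L).symm x))
  have h2 := (modelEquiv L : E →L[ℝ] 𝔤).hasFDerivAt.comp_hasDerivAt t h1
  rw [ContinuousLinearEquiv.coe_coe, hL.modelEquiv_chartBracket] at h2
  refine h2.congr_of_eventuallyEq (Eventually.of_forall fun s => ?_)
  simp only [Function.comp_apply, adjointCLM_apply]
  rw [← ContinuousLinearMap.comp_apply, ← chartAd_mul, inv_mul_cancel_right]

omit [LieGroup 𝓘(ℝ, E) ∞ G] in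
theorem exists_hasRightLogDerivAt_zero (ξ : E) :
    ∃ γ : ℝ → G, γ 0 = 1 ∧ HasRightLogDerivAt γ ξ 0 := by
  have hl : HasDerivAt (fun s : ℝ => unitChart E G 1 + s • ξ) ξ 0 := by
    simpa using ((hasDerivAt_id (0 : ℝ)).smul_const ξ).const_add (unitChart E G 1)
  have ht : Tendsto (fun s : ℝ => unitChart E G 1 + s • ξ) (𝓝 0) (𝓝 (unitChart E G 1)) := by
    simpa using hl.continuousAt.tendsto
  have h0 : (unitChart E G).symm (unitChart E G 1 + (0 : ℝ) • ξ) = 1 := by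
    rw [zero_smul, add_zero, unitChart_symm_one]
  refine ⟨fun s => (unitChart E G).symm (unitChart E G 1 + s • ξ), h0, ?_, ?_⟩
  · rw [ContinuousAt, h0]
    exact tendsto_unitChart_symm.comp ht
  · refine hl.congr_of_eventuallyEq ?_
    filter_upwards [ht.eventually eventually_unitChart_apply_symm] with s hs
    rw [h0, inv_one, mul_one, hs]

omit [LieGroup 𝓘(ℝ, E) ∞ G] in
variable {L} in
theorem IsExpCurve.map_zero {X : 𝔤} {c : ℝ → G} (h : IsExpCurve L X c) : c 0 = 1 := by
  have h1 := h.map_add 0 0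
  rw [add_zero] at h1
  exact (mul_eq_left.1 h1.symm)

omit [LieGroup 𝓘(ℝ, E) ∞ G] in
variable {L} in
theorem IsExpCurve.hasRightLogDerivAt {X : 𝔤} {c : ℝ → G} (h : IsExpCurve L X c) (t : ℝ) :
    HasRightLogDerivAt c ((modelEquiv L).symm X) t := by
  refine ⟨h.smooth.continuous.continuousAt, ?_⟩
  have h1 := (h.smooth.contMDiffAt (x := 0)).mdifferentiableAt (by simp) |>.hasMFDerivAt.2
  rw [writtenInExtChartAt, h.map_zero, ModelWithCorners.range_eq_univ] at h1
  have h2 : HasFDerivAt (fun s => unitChart E G (c s))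
      (show ℝ →L[ℝ] E from mfderiv 𝓘(ℝ, ℝ) 𝓘(ℝ, E) c 0) 0 := hasFDerivWithinAt_univ.1 h1
  have h3 : (show ℝ →L[ℝ] E from mfderiv 𝓘(ℝ, ℝ) 𝓘(ℝ, E) c 0) 1 = (modelEquiv L).symm X := by
    rw [← h.velocity]
    exact ((modelEquiv L).symm_apply_apply _).symm
  have h4 := h2.hasDerivAt
  rw [h3] at h4
  have h5 : HasDerivAt (fun s => s - t) 1 t := (hasDerivAt_id t).sub_const t
  have h6 := HasDerivAt.scomp_of_eq t h4 h5 (sub_self t).symm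
  rw [one_smul] at h6
  refine h6.congr_of_eventuallyEq (Eventually.of_forall fun s => ?_)
  have h7 : c s = c (s - t) * c t := by rw [← h.map_add, sub_add_cancel]
  simp only [Function.comp_apply, h7, mul_inv_cancel_right]

variable {L} in
/-- The adjoint action of `exp (tX)` fixes the elements commuting with `X`. -/
theorem IsExpCurve.adjointCLM_eq [CompleteSpace E] (hL : IsLieAlgebraIso br L) {X x : 𝔤}
    {c : ℝ → G} (h : IsExpCurve L X c) (hX : br X x = 0) (t : ℝ) : adjointCLM L (c t) x = x := by
  have hd : ∀ t, HasDerivAt (fun s => adjointCLM L (c s) x) 0 t := by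
    intro t
    have h1 := (h.hasRightLogDerivAt 0).hasDerivAt_adjoint hL x
    rw [ContinuousLinearEquiv.apply_symm_apply, h.map_zero, adjointCLM_one, hX] at h1
    have h2 : HasDerivAt (fun s => s - t) 1 t := (hasDerivAt_id t).sub_const t
    have h3 := HasDerivAt.scomp_of_eq t h1 h2 (sub_self t).symm
    -- `Ad_{c(s)} x = Ad_{c(t)} (Ad_{c(s-t)} x)` reduces the derivative at `t` to the one at `0`
    have h4 := (adjointCLM L (c t)).hasFDerivAt.comp_hasDerivAt t h3
    rw [smul_zero, _root_.map_zero] at h4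
    refine h4.congr_of_eventuallyEq (Eventually.of_forall fun s => ?_)
    simp only [Function.comp_apply]
    rw [← adjointCLM_mul, ← h.map_add, add_sub_cancel]
  have hc := is_const_of_deriv_eq_zero (fun t => (hd t).differentiableAt) (fun t => (hd t).deriv)
    t 0
  rw [hc, h.map_zero, adjointCLM_one]

omit [LieGroup 𝓘(ℝ, E) ∞ G] in
variable {L} in
/-- The right logarithmic derivative of a curve in a Banach Lie subgroup lies in its Lie
algebra. -/
theorem IsBanachLieSubgroup.hasRightLogDerivAt_comp {j : K →* G} {𝔨 : Submodule 𝕜 𝔤}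
    (hj : IsBanachLieSubgroup (E' := E') L j 𝔨) {γ : ℝ → K} {t : ℝ}
    (h : ContMDiffAt 𝓘(ℝ, ℝ) 𝓘(ℝ, E') ∞ γ t) :
    ∃ ξ : E, modelEquiv L ξ ∈ 𝔨 ∧ HasRightLogDerivAt (fun s => j (γ s)) ξ t := by
  obtain ⟨η, hη⟩ := ContMDiffAt.exists_hasRightLogDerivAt h
  refine ⟨_, ?_, hη.comp_monoidHom j hj.smooth⟩
  rw [← SetLike.mem_coe, ← hj.range_deriv]
  exact ⟨η, rfl⟩

end AdjointAction

/-! ### `Ad`-invariant functions and pairings -/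

section Invariance

open Filter Topology

variable {𝕜 𝔤 : Type*} [RCLike 𝕜] [NormedAddCommGroup 𝔤] [NormedSpace 𝕜 𝔤] [NormedSpace ℝ 𝔤]
  [IsScalarTower ℝ 𝕜 𝔤]
  {E : Type*} [NormedAddCommGroup E] [NormedSpace ℝ E] [CompleteSpace E]
  {G : Type*} [TopologicalSpace G] [ChartedSpace E G] [Group G] [LieGroup 𝓘(ℝ, E) ∞ G]
  {br : 𝔤 →L[𝕜] 𝔤 →L[𝕜] 𝔤} {B : 𝔤 →L[𝕜] 𝔤 →L[𝕜] 𝕜} {H : 𝔤 → 𝕜}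
  {L : GroupLieAlgebra 𝓘(ℝ, E) G ≃L[ℝ] 𝔤}

/-- An `Ad`-invariant function is `ad`-invariant. -/
theorem isAdInvariantFun_of_adjoint_invariant (hL : IsLieAlgebraIso br L) (hH : H ∈ admissible B)
    (h : ∀ (g : G) x, H (adjoint L g x) = H x) : IsAdInvariantFun br H := by
  intro x y
  obtain ⟨γ, h0, hγ⟩ := exists_hasRightLogDerivAt_zero (G := G) ((modelEquiv L).symm y)
  have h1 := hγ.hasDerivAt_adjoint hL x
  rw [ContinuousLinearEquiv.apply_symm_apply, h0, adjointCLM_one] at h1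
  have h2 : HasFDerivAt H ((fderiv 𝕜 H x).restrictScalars ℝ) x :=
    (differentiableAt_of_mem_admissible hH x).hasFDerivAt.restrictScalars ℝ
  have h3 := HasFDerivAt.comp_hasDerivAt_of_eq 0 h2 h1 (by rw [h0, adjointCLM_one])
  have h4 : H ∘ (fun s => adjointCLM L (γ s) x) = fun _ => H x := by
    ext s
    exact h (γ s) x
  rw [h4] at h3
  exact h3.unique (hasDerivAt_const 0 (H x))

/-- The pairing is `Ad`-invariant along curves in `G` starting at the identity. -/
theorem pairing_adjointCLM_eq (hL : IsLieAlgebraIso br L) (hinv : IsInvariantPairing br B)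
    {γ : ℝ → G} {J : Set ℝ} (hJ : IsOpen J) (hJc : J.OrdConnected) (h0J : 0 ∈ J) (h0 : γ 0 = 1)
    (hγ : ∀ t ∈ J, ∃ ξ : E, HasRightLogDerivAt γ ξ t) {t : ℝ} (ht : t ∈ J) (x y : 𝔤) :
    B (adjointCLM L (γ t) x) (adjointCLM L (γ t) y) = B x y := by
  have hd : ∀ s ∈ J,
      HasDerivAt (fun s => B (adjointCLM L (γ s) x) (adjointCLM L (γ s) y)) 0 s := by
    intro s hs
    obtain ⟨ξ, hξ⟩ := hγ s hs
    have h1 := (B.bilinearRestrictScalars ℝ).hasDerivAt_of_bilinear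
      (fun _ => hξ.hasDerivAt_adjoint hL x) (fun _ => hξ.hasDerivAt_adjoint hL y)
    refine h1.congr_deriv ?_
    have h2 := hinv (modelEquiv L ξ) (adjointCLM L (γ s) x) (adjointCLM L (γ s) y)
    rw [add_comm] at h2
    exact h2
  have hc := hJ.is_const_of_deriv_eq_zero hJc.isPreconnected
    (fun s hs => (hd s hs).differentiableAt.differentiableWithinAt) (fun s hs => (hd s hs).deriv)
    ht h0J
  simp only [h0, adjointCLM_one] at hc
  exact hc

omit [CompleteSpace E] in
/-- The gradient of an `Ad`-invariant function is `Ad`-equivariant. -/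
theorem grad_adjointCLM (hB : IsDualityPairing B) (hH : H ∈ admissible B) {g : G}
    (h : ∀ x, H (adjoint L g x) = H x)
    (hg : ∀ x y, B (adjointCLM L g x) (adjointCLM L g y) = B x y) (x : 𝔤) :
    grad B H (adjointCLM L g x) = adjointCLM L g (grad B H x) := by
  rw [← sub_eq_zero]
  refine hB.left _ fun z => ?_
  obtain ⟨y, rfl⟩ := adjointCLM_surjective L g z
  have hd (x : 𝔤) : HasFDerivAt H ((fderiv 𝕜 H x).restrictScalars ℝ) x :=
    (differentiableAt_of_mem_admissible hH x).hasFDerivAt.restrictScalars ℝ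
  have h1 := (hd (adjointCLM L g x)).comp x (adjointCLM L g).hasFDerivAt
  have h2 : H ∘ adjointCLM L g = H := funext h
  rw [h2] at h1
  have h3 := DFunLike.congr_fun (h1.unique (hd x)) y
  simp only [ContinuousLinearMap.comp_apply, ContinuousLinearMap.coe_restrictScalars',
    grad_spec hH] at h3
  rw [map_sub, sub_apply, h3, hg, sub_self]

end Invariance

/-! ### Uniqueness of integral curves -/

section Uniqueness

open Filter Topology

/-- Integral curves of a `C¹` vector field on an open interval are determined by one value. -/
theorem eqOn_of_isIntegralCurveOn {V : Type*} [NormedAddCommGroup V] [NormedSpace ℝ V] {X : V → V}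
    (hX : ContDiff ℝ 1 X) {J : Set ℝ} (hJ : IsOpen J) (hJc : J.OrdConnected) {t₀ : ℝ}
    (ht₀ : t₀ ∈ J) {y z : ℝ → V} (hy : IsIntegralCurveOn y (fun _ => X) J)
    (hz : IsIntegralCurveOn z (fun _ => X) J) (h : y t₀ = z t₀) : Set.EqOn y z J := by
  have hy' : ∀ t ∈ J, HasDerivAt y (X (y t)) t := fun t ht =>
    (hy t ht).hasDerivAt (hJ.mem_nhds ht)
  have hz' : ∀ t ∈ J, HasDerivAt z (X (z t)) t := fun t ht =>
    (hz t ht).hasDerivAt (hJ.mem_nhds ht)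
  have hloc : ∀ t ∈ J, y t = z t → y =ᶠ[𝓝 t] z := by
    intro t ht hyz
    obtain ⟨K, s, hs, hK⟩ := (hX.contDiffAt (x := y t)).exists_lipschitzOnWith
    refine ODE_solution_unique_of_eventually (v := fun _ => X) (s := fun _ => s) (K := K)
      (Eventually.of_forall fun _ => hK) ?_ ?_ hyz
    · filter_upwards [hJ.mem_nhds ht, (hy' t ht).continuousAt.eventually_mem hs] with r hr hr'
      exact ⟨hy' r hr, hr'⟩
    · rw [hyz] at hs
      filter_upwards [hJ.mem_nhds ht, (hz' t ht).continuousAt.eventually_mem hs] with r hr hr'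
      exact ⟨hz' r hr, hr'⟩
  have hsub : J ⊆ {t | y =ᶠ[𝓝 t] z} := by
    refine hJc.isPreconnected.subset_of_closure_inter_subset ?_ ⟨t₀, ht₀, hloc t₀ ht₀ h⟩ ?_
    · rw [isOpen_iff_mem_nhds]
      exact fun t ht => eventually_eventually_nhds.2 ht
    · rintro t ⟨htc, htJ⟩
      refine hloc t htJ ?_
      have hf : ∃ᶠ s in 𝓝 t, y s = z s :=
        (mem_closure_iff_frequently.1 htc).mono fun s hs => hs.self_of_nhds
      by_contra hne
      exact hf (((hy' t htJ).continuousAt.ne_iff_eventually_ne (hz' t htJ).continuousAt).1 hne)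
  exact fun t ht => (hsub ht).self_of_nhds

end Uniqueness


/-! ### The factorization problem -/

section Factorization

open Filter Topology

variable {𝕜 𝔤 : Type*} [RCLike 𝕜] [NormedAddCommGroup 𝔤] [NormedSpace 𝕜 𝔤] [NormedSpace ℝ 𝔤]
  {E : Type*} [NormedAddCommGroup E] [NormedSpace ℝ E]
  {G : Type*} [TopologicalSpace G] [ChartedSpace E G] [Group G] [LieGroup 𝓘(ℝ, E) ∞ G]
  {Ep : Type*} [NormedAddCommGroup Ep] [NormedSpace ℝ Ep]
  {Gp : Type*} [TopologicalSpace Gp] [ChartedSpace Ep Gp] [Group Gp] [LieGroup 𝓘(ℝ, Ep) ∞ Gp]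
  {Em : Type*} [NormedAddCommGroup Em] [NormedSpace ℝ Em]
  {Gm : Type*} [TopologicalSpace Gm] [ChartedSpace Em Gm] [Group Gm] [LieGroup 𝓘(ℝ, Em) ∞ Gm]
  {L : GroupLieAlgebra 𝓘(ℝ, E) G ≃L[ℝ] 𝔤} {j : Gp →* G} {k : Gm →* G} {𝔤p 𝔤m : Submodule 𝕜 𝔤}

omit [LieGroup 𝓘(ℝ, E) ∞ G] in
theorem contDiffAt_chartRep {f : Gp →* G} (hf : ContMDiff 𝓘(ℝ, Ep) 𝓘(ℝ, E) ∞ f) :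
    ContDiffAt ℝ ∞ (chartRep (E := E) (E' := Ep) f) (unitChart Ep Gp 1) := by
  rw [← contMDiffAt_iff_contDiffAt]
  have h3 : ContMDiffAt 𝓘(ℝ, E) 𝓘(ℝ, E) ∞ (unitChart E G)
      (f ((unitChart Ep Gp).symm (unitChart Ep Gp 1))) := by
    rw [unitChart_symm_one, map_one]
    exact contMDiffAt_extChartAt
  exact h3.comp (unitChart Ep Gp 1) (hf.contMDiffAt.comp _ contMDiffAt_unitChart_symm)

omit [LieGroup 𝓘(ℝ, E) ∞ G] [LieGroup 𝓘(ℝ, Ep) ∞ Gp] [LieGroup 𝓘(ℝ, Em) ∞ Gm] in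
/-- The derivative at `(1, 1)` of `(a, b) ↦ a b` on `G₊ × G₋` is bijective, because
`𝔤 = 𝔤₊ ⊕ 𝔤₋`. -/
theorem bijective_coprod_mfderiv (hc : IsCompl 𝔤p 𝔤m)
    (hj : IsBanachLieSubgroup (E' := Ep) L j 𝔤p) (hk : IsBanachLieSubgroup (E' := Em) L k 𝔤m) :
    Function.Bijective ((show Ep →L[ℝ] E from mfderiv 𝓘(ℝ, Ep) 𝓘(ℝ, E) j 1).coprod
      (show Em →L[ℝ] E from mfderiv 𝓘(ℝ, Em) 𝓘(ℝ, E) k 1)) := by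
  set dj : Ep →L[ℝ] E := mfderiv 𝓘(ℝ, Ep) 𝓘(ℝ, E) j 1
  set dk : Em →L[ℝ] E := mfderiv 𝓘(ℝ, Em) 𝓘(ℝ, E) k 1
  have hp (v : Ep) : modelEquiv L (dj v) ∈ 𝔤p := by
    rw [← SetLike.mem_coe, ← hj.range_deriv]
    exact ⟨v, rfl⟩
  have hm (w : Em) : modelEquiv L (dk w) ∈ 𝔤m := by
    rw [← SetLike.mem_coe, ← hk.range_deriv]
    exact ⟨w, rfl⟩
  have ij : Function.Injective fun v => modelEquiv L (dj v) := hj.injective_deriv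
  have ik : Function.Injective fun w => modelEquiv L (dk w) := hk.injective_deriv
  constructor
  · rw [injective_iff_map_eq_zero]
    rintro ⟨v, w⟩ h
    rw [ContinuousLinearMap.coprod_apply] at h
    have h1 : modelEquiv L (dj v) = -modelEquiv L (dk w) := by
      rw [eq_neg_iff_add_eq_zero, ← map_add, h, map_zero]
    have h2 : modelEquiv L (dj v) = 0 :=
      Submodule.disjoint_def.1 hc.disjoint _ (hp v) (h1 ▸ neg_mem (hm w))
    have h3 : modelEquiv L (dk w) = 0 := by rw [← neg_eq_zero, ← h1, h2]
    have hv : v = 0 := ij (by simp [h2])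
    have hw : w = 0 := ik (by simp [h3])
    rw [hv, hw]
    rfl
  · intro u
    obtain ⟨a, ha, b, hb, hab⟩ := Submodule.mem_sup.1
      (hc.sup_eq_top ▸ Submodule.mem_top : modelEquiv L u ∈ 𝔤p ⊔ 𝔤m)
    rw [← SetLike.mem_coe, ← hj.range_deriv] at ha
    rw [← SetLike.mem_coe, ← hk.range_deriv] at hb
    obtain ⟨v, rfl⟩ := ha
    obtain ⟨w, rfl⟩ := hb
    refine ⟨(v, w), (modelEquiv L).injective ?_⟩
    rw [ContinuousLinearMap.coprod_apply, map_add]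
    exact hab

/-- By the inverse function theorem, elements of `G` near the identity factor uniquely and smoothly
as products of elements of `G₊` and `G₋` near the identities. -/
theorem exists_local_factorization [CompleteSpace E] [CompleteSpace Ep] [CompleteSpace Em]
    (hc : IsCompl 𝔤p 𝔤m) (hj : IsBanachLieSubgroup (E' := Ep) L j 𝔤p)
    (hk : IsBanachLieSubgroup (E' := Em) L k 𝔤m) :
    ∃ (s : G → Gp) (r : G → Gm), ContMDiffAt 𝓘(ℝ, E) 𝓘(ℝ, Ep) ∞ s 1 ∧
      ContMDiffAt 𝓘(ℝ, E) 𝓘(ℝ, Em) ∞ r 1 ∧ (∀ᶠ g in 𝓝 1, j (s g) * k (r g) = g) ∧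
      ∀ᶠ p : Gp × Gm in 𝓝 1, s (j p.1 * k p.2) = p.1 ∧ r (j p.1 * k p.2) = p.2 := by
  have : IsTopologicalGroup G := topologicalGroup_of_lieGroup 𝓘(ℝ, E) ∞
  set e := unitChart E G 1 with he
  set ep := unitChart Ep Gp 1 with hep
  set em := unitChart Em Gm 1 with hem
  set μ : Ep × Em → E := fun p => chartMul E G
    (chartRep (E := E) (E' := Ep) j p.1, chartRep (E := E) (E' := Em) k p.2) with hμ
  have ej : chartRep (E := E) (E' := Ep) j ep = e := chartRep_one (map_one j)
  have ek : chartRep (E := E) (E' := Em) k em = e := chartRep_one (map_one k)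
  have hμe : μ (ep, em) = e := by
    simp only [hμ, ej, ek, chartMul, he, unitChart_symm_one, mul_one]
  have dj := hasFDerivAt_chartRep (f := j) (map_one j)
    (hj.smooth.contMDiffAt.mdifferentiableAt (by simp))
  have dk := hasFDerivAt_chartRep (f := k) (map_one k)
    (hk.smooth.contMDiffAt.mdifferentiableAt (by simp))
  set dj' : Ep →L[ℝ] E := mfderiv 𝓘(ℝ, Ep) 𝓘(ℝ, E) j 1 with hdj'
  set dk' : Em →L[ℝ] E := mfderiv 𝓘(ℝ, Em) 𝓘(ℝ, E) k 1 with hdk'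
  have hsm : ContDiffAt ℝ ∞ μ (ep, em) := by
    have h1 : ContDiffAt ℝ ∞ (fun p : Ep × Em => chartRep (E := E) (E' := Ep) j p.1) (ep, em) :=
      ContDiffAt.comp (g := chartRep (E := E) (E' := Ep) j) (f := Prod.fst) (ep, em)
        (contDiffAt_chartRep hj.smooth) contDiffAt_fst
    have h2 : ContDiffAt ℝ ∞ (fun p : Ep × Em => chartRep (E := E) (E' := Em) k p.2) (ep, em) :=
      ContDiffAt.comp (g := chartRep (E := E) (E' := Em) k) (f := Prod.snd) (ep, em)
        (contDiffAt_chartRep hk.smooth) contDiffAt_snd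
    have h3 : ContDiffAt ℝ ∞ (chartMul E G) (chartRep (E := E) (E' := Ep) j (ep, em).1,
        chartRep (E := E) (E' := Em) k (ep, em).2) := by
      rw [ej, ek]
      exact contDiffAt_chartMul
    exact ContDiffAt.comp (g := chartMul E G)
      (f := fun p : Ep × Em => (chartRep (E := E) (E' := Ep) j p.1,
        chartRep (E := E) (E' := Em) k p.2)) (ep, em) h3 (h1.prodMk h2)
  have hbij : Function.Bijective (dj'.coprod dk') := bijective_coprod_mfderiv hc hj hk
  let T : (Ep × Em) ≃L[ℝ] E := ContinuousLinearEquiv.ofBijective (dj'.coprod dk')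
    (LinearMap.ker_eq_bot.2 hbij.1) (LinearMap.range_eq_top.2 hbij.2)
  have hd : HasFDerivAt μ (T : Ep × Em →L[ℝ] E) (ep, em) := by
    have h1 : HasFDerivAt (fun p : Ep × Em => chartRep (E := E) (E' := Ep) j p.1)
        (dj'.comp (ContinuousLinearMap.fst ℝ Ep Em)) (ep, em) :=
      HasFDerivAt.comp (g := chartRep (E := E) (E' := Ep) j) (f := Prod.fst) (ep, em) dj
        hasFDerivAt_fst
    have h2 : HasFDerivAt (fun p : Ep × Em => chartRep (E := E) (E' := Em) k p.2)
        (dk'.comp (ContinuousLinearMap.snd ℝ Ep Em)) (ep, em) :=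
      HasFDerivAt.comp (g := chartRep (E := E) (E' := Em) k) (f := Prod.snd) (ep, em) dk
        hasFDerivAt_snd
    have h3 : HasFDerivAt (chartMul E G) (fderiv ℝ (chartMul E G) (e, e))
        (chartRep (E := E) (E' := Ep) j (ep, em).1, chartRep (E := E) (E' := Em) k (ep, em).2) := by
      rw [ej, ek]
      exact (contDiffAt_chartMul.differentiableAt (by simp)).hasFDerivAt
    refine (h3.comp (ep, em) (h1.prodMk h2)).congr_fderiv ?_
    ext <;> simp [T, he, fderiv_chartMul_apply]
  let Φ := hsm.toOpenPartialHomeomorph μ hd (by simp)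
  have hΦ : ∀ p, Φ p = μ p := fun p => rfl
  have hsrc : (ep, em) ∈ Φ.source := hsm.mem_toOpenPartialHomeomorph_source hd (by simp)
  have htgt : e ∈ Φ.target := hμe ▸ Φ.map_source hsrc
  have hΦe : Φ.symm e = (ep, em) := by
    rw [← hμe, ← hΦ, Φ.left_inv hsrc]
  have hinv : ContDiffAt ℝ ∞ Φ.symm e := by
    have h := hsm.to_localInverse hd (by simp)
    rw [hμe] at h
    exact h
  have hinvG : ContMDiffAt 𝓘(ℝ, E) 𝓘(ℝ, Ep × Em) ∞ (fun g : G => Φ.symm (unitChart E G g)) 1 :=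
    (contMDiffAt_iff_contDiffAt.2 hinv).comp (1 : G) contMDiffAt_extChartAt
  have hΦ1 : Φ.symm (unitChart E G 1) = (ep, em) := hΦe
  have hs : ContMDiffAt 𝓘(ℝ, E) 𝓘(ℝ, Ep) ∞
      (fun g : G => (unitChart Ep Gp).symm (Φ.symm (unitChart E G g)).1) 1 := by
    have h1 : ContMDiffAt 𝓘(ℝ, Ep) 𝓘(ℝ, Ep) ∞ (unitChart Ep Gp).symm
        (Φ.symm (unitChart E G 1)).1 := by
      rw [hΦ1]
      exact contMDiffAt_unitChart_symm
    exact h1.comp (1 : G) ((contDiffAt_fst.contMDiffAt).comp (1 : G) hinvG)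
  have hr : ContMDiffAt 𝓘(ℝ, E) 𝓘(ℝ, Em) ∞
      (fun g : G => (unitChart Em Gm).symm (Φ.symm (unitChart E G g)).2) 1 := by
    have h1 : ContMDiffAt 𝓘(ℝ, Em) 𝓘(ℝ, Em) ∞ (unitChart Em Gm).symm
        (Φ.symm (unitChart E G 1)).2 := by
      rw [hΦ1]
      exact contMDiffAt_unitChart_symm
    exact h1.comp (1 : G) ((contDiffAt_snd.contMDiffAt).comp (1 : G) hinvG)
  have hjc : Tendsto j (𝓝 1) (𝓝 1) := by simpa using hj.smooth.continuous.tendsto 1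
  have hkc : Tendsto k (𝓝 1) (𝓝 1) := by simpa using hk.smooth.continuous.tendsto 1
  have hfst : Tendsto (fun p : Gp × Gm => p.1) (𝓝 1) (𝓝 1) := continuous_fst.tendsto 1
  have hsnd : Tendsto (fun p : Gp × Gm => p.2) (𝓝 1) (𝓝 1) := continuous_snd.tendsto 1
  have hprod : Tendsto (fun p : Gp × Gm => j p.1 * k p.2) (𝓝 1) (𝓝 1) := by
    simpa using (hjc.comp hfst).mul (hkc.comp hsnd)
  -- `μ` is the multiplication map read in the charts
  have hμφ : ∀ᶠ p : Gp × Gm in 𝓝 1,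
      μ (unitChart Ep Gp p.1, unitChart Em Gm p.2) = unitChart E G (j p.1 * k p.2) := by
    filter_upwards [hfst.eventually (eventually_unitChart_symm_apply (E := Ep)),
      hsnd.eventually (eventually_unitChart_symm_apply (E := Em)),
      (hjc.comp hfst).eventually (eventually_unitChart_symm_apply (E := E)),
      (hkc.comp hsnd).eventually (eventually_unitChart_symm_apply (E := E))] with p h1 h2 h3 h4
    simp only [Function.comp_apply] at h3 h4
    simp only [hμ, chartRep_unitChart h1, chartRep_unitChart h2, chartMul, h3, h4]
  refine ⟨_, _, hs, hr, ?_, ?_⟩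
  · have hs1 : Tendsto (fun g : G => ((unitChart Ep Gp).symm (Φ.symm (unitChart E G g)).1,
        (unitChart Em Gm).symm (Φ.symm (unitChart E G g)).2)) (𝓝 1) (𝓝 (1 : Gp × Gm)) := by
      have h := hs.continuousAt.tendsto.prodMk_nhds hr.continuousAt.tendsto
      rw [hΦ1, unitChart_symm_one, unitChart_symm_one] at h
      exact h
    have hinvc : Tendsto (fun g : G => Φ.symm (unitChart E G g)) (𝓝 1) (𝓝 (ep, em)) := by
      rw [← hΦ1]
      exact hinvG.continuousAt.tendsto
    have hpc : Tendsto (fun p : Ep × Em => p.1) (𝓝 (ep, em)) (𝓝 ep) :=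
      continuous_fst.tendsto (ep, em)
    have hmc : Tendsto (fun p : Ep × Em => p.2) (𝓝 (ep, em)) (𝓝 em) :=
      continuous_snd.tendsto (ep, em)
    have hφt : ∀ᶠ g : G in 𝓝 1, unitChart E G g ∈ Φ.target :=
      continuousAt_unitChart.eventually_mem (Φ.open_target.mem_nhds htgt)
    filter_upwards [hs1.eventually hμφ, hφt,
      (hpc.comp hinvc).eventually (eventually_unitChart_apply_symm (E := Ep) (G := Gp)),
      (hmc.comp hinvc).eventually (eventually_unitChart_apply_symm (E := Em) (G := Gm)),
      eventually_unitChart_symm_apply (E := E) (G := G),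
      (hprod.comp hs1).eventually (eventually_unitChart_symm_apply (E := E))]
      with g h1 h2 h3 h4 h5 h6
    simp only [Function.comp_apply] at h3 h4 h6
    rw [h3, h4, Prod.mk.eta, ← hΦ, Φ.right_inv h2] at h1
    rw [← h6, ← h1, h5]
  · have hφφ : Tendsto (fun p : Gp × Gm => (unitChart Ep Gp p.1, unitChart Em Gm p.2)) (𝓝 1)
        (𝓝 (ep, em)) :=
      (continuousAt_unitChart.tendsto.comp hfst).prodMk_nhds
        (continuousAt_unitChart.tendsto.comp hsnd)
    filter_upwards [hμφ, hφφ.eventually_mem (Φ.open_source.mem_nhds hsrc),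
      hfst.eventually (eventually_unitChart_symm_apply (E := Ep)),
      hsnd.eventually (eventually_unitChart_symm_apply (E := Em))] with p h1 h2 h3 h4
    rw [← h1, ← hΦ, Φ.left_inv h2]
    exact ⟨h3, h4⟩

/-- The pairs `(a, b) ∈ G₊ × G₋` with the same image in `G`, i.e. the fibre over the identity of
`(a, b) ↦ a⁻¹ b`. -/
def factorKernel (j : Gp →* G) (k : Gm →* G) : Subgroup (Gp × Gm) :=
  (j.comp (MonoidHom.fst Gp Gm)).eqLocus (k.comp (MonoidHom.snd Gp Gm))

/-- If `G = G₊ G₋`, then `(a, b) ↦ a⁻¹ b` is a covering map `G₊ × G₋ → G`: it is open, and its fibres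
are the orbits of the discrete subgroup `factorKernel`. -/
theorem isCoveringMap_factor [CompleteSpace E] [CompleteSpace Ep] [CompleteSpace Em]
    (hc : IsCompl 𝔤p 𝔤m) (hj : IsBanachLieSubgroup (E' := Ep) L j 𝔤p)
    (hk : IsBanachLieSubgroup (E' := Em) L k 𝔤m) (hG : ∀ g : G, ∃ a b, g = j a * k b) :
    IsCoveringMap fun p : Gp × Gm => (j p.1)⁻¹ * k p.2 := by
  have : IsTopologicalGroup G := topologicalGroup_of_lieGroup 𝓘(ℝ, E) ∞
  have : IsTopologicalGroup Gp := topologicalGroup_of_lieGroup 𝓘(ℝ, Ep) ∞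
  have : IsTopologicalGroup Gm := topologicalGroup_of_lieGroup 𝓘(ℝ, Em) ∞
  obtain ⟨s, r, hs, hr, hsr, hsr'⟩ := exists_local_factorization hc hj hk
  have hs1 : s 1 = 1 := by simpa using hsr'.self_of_nhds.1
  have hr1 : r 1 = 1 := by simpa using hsr'.self_of_nhds.2
  have hjc := hj.smooth.continuous
  have hkc := hk.smooth.continuous
  have hcont : Continuous fun p : Gp × Gm => (j p.1)⁻¹ * k p.2 := by fun_prop
  have hopen : IsOpenMap fun p : Gp × Gm => (j p.1)⁻¹ * k p.2 := by
    rw [isOpenMap_iff_nhds_le]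
    rintro ⟨a, b⟩ U hU
    -- translate the local factorization from the identity to `a⁻¹ b`
    have h1 : Tendsto (fun g => j a * g * (k b)⁻¹) (𝓝 ((j a)⁻¹ * k b)) (𝓝 1) := by
      have h : Continuous fun g => j a * g * (k b)⁻¹ := by fun_prop
      have h' := h.tendsto ((j a)⁻¹ * k b)
      rwa [mul_inv_cancel_left, mul_inv_cancel] at h'
    have hs' : Tendsto s (𝓝 1) (𝓝 1) := by simpa [ContinuousAt, hs1] using hs.continuousAt
    have hr' : Tendsto r (𝓝 1) (𝓝 1) := by simpa [ContinuousAt, hr1] using hr.continuousAt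
    have h2 : Tendsto (fun g => ((s (j a * g * (k b)⁻¹))⁻¹ * a, r (j a * g * (k b)⁻¹) * b))
        (𝓝 ((j a)⁻¹ * k b)) (𝓝 (a, b)) := by
      have e1 := ((hs'.comp h1).inv).mul_const a
      have e2 := (hr'.comp h1).mul_const b
      rw [inv_one, one_mul] at e1
      rw [one_mul] at e2
      exact e1.prodMk_nhds e2
    filter_upwards [h2.eventually_mem hU, h1.eventually hsr] with g hg hg'
    have h3 : (j ((s (j a * g * (k b)⁻¹))⁻¹ * a))⁻¹ * k (r (j a * g * (k b)⁻¹) * b) = g := by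
      rw [map_mul, map_inv, map_mul, mul_inv_rev, inv_inv, mul_assoc, ← mul_assoc (j _) (k _), hg']
      group
    rw [← h3]
    exact hg
  have hsurj : Function.Surjective fun p : Gp × Gm => (j p.1)⁻¹ * k p.2 := by
    intro g
    obtain ⟨a, b, rfl⟩ := hG g
    exact ⟨(a⁻¹, b), by simp⟩
  have hdisc : IsDiscrete (factorKernel j k : Set (Gp × Gm)) := by
    have h1 : Tendsto (fun p : factorKernel j k => (((p : Gp × Gm).1)⁻¹, (p : Gp × Gm).2)) (𝓝 1)
        (𝓝 1) := by
      have h : Continuous fun p : factorKernel j k => (((p : Gp × Gm).1)⁻¹, (p : Gp × Gm).2) := by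
        fun_prop
      have h' := h.tendsto 1
      simp only [OneMemClass.coe_one, Prod.fst_one, Prod.snd_one, inv_one] at h'
      exact h'
    have h2 : DiscreteTopology (factorKernel j k) := by
      refine discreteTopology_of_isOpen_singleton_one (isOpen_iff_mem_nhds.2 ?_)
      rintro _ rfl
      filter_upwards [h1.eventually hsr'] with p hp
      have hp' : j (p : Gp × Gm).1 = k (p : Gp × Gm).2 := p.2
      rw [map_inv, hp', inv_mul_cancel, hs1, hr1] at hp
      exact Subtype.ext (Prod.ext (inv_eq_one.1 hp.1.symm) hp.2.symm)
    exact ⟨h2⟩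
  exact ((hopen.isQuotientMap hcont hsurj).isQuotientCoveringMap_of_subgroup (factorKernel j k)
    hdisc (by
      rintro ⟨a₁, b₁⟩ ⟨a₂, b₂⟩
      change _ ↔ j (a₂ * a₁⁻¹) = k (b₂ * b₁⁻¹)
      simp only [map_mul, map_inv]
      rw [eq_inv_mul_iff_mul_eq, ← mul_assoc, ← eq_mul_inv_iff_mul_eq])).isCoveringMap

/-- Continuous factorizations of smooth curves are smooth. -/
theorem contMDiffAt_of_factor [CompleteSpace E] [CompleteSpace Ep] [CompleteSpace Em]
    (hc : IsCompl 𝔤p 𝔤m) (hj : IsBanachLieSubgroup (E' := Ep) L j 𝔤p)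
    (hk : IsBanachLieSubgroup (E' := Em) L k 𝔤m) {c : ℝ → G} {a : ℝ → Gp} {b : ℝ → Gm} {t : ℝ}
    (hct : ContMDiffAt 𝓘(ℝ, ℝ) 𝓘(ℝ, E) ∞ c t) (ha : ContinuousAt a t) (hb : ContinuousAt b t)
    (h : ∀ u, c u = (j (a u))⁻¹ * k (b u)) :
    ContMDiffAt 𝓘(ℝ, ℝ) 𝓘(ℝ, Ep) ∞ a t ∧ ContMDiffAt 𝓘(ℝ, ℝ) 𝓘(ℝ, Em) ∞ b t := by
  have : IsTopologicalGroup G := topologicalGroup_of_lieGroup 𝓘(ℝ, E) ∞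
  have : IsTopologicalGroup Gp := topologicalGroup_of_lieGroup 𝓘(ℝ, Ep) ∞
  have : IsTopologicalGroup Gm := topologicalGroup_of_lieGroup 𝓘(ℝ, Em) ∞
  obtain ⟨s, r, hs, hr, -, hsr⟩ := exists_local_factorization hc hj hk
  have hd : ContMDiffAt 𝓘(ℝ, ℝ) 𝓘(ℝ, E) ∞ (fun u => j (a t) * c u * (k (b t))⁻¹) t :=
    (contMDiffAt_const.mul hct).mul contMDiffAt_const
  have h1 : j (a t) * c t * (k (b t))⁻¹ = 1 := by rw [h t]; group
  have hl : Tendsto (fun u => (a t * (a u)⁻¹, b u * (b t)⁻¹)) (𝓝 t) (𝓝 1) := by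
    have e1 : Tendsto (fun u => a t * (a u)⁻¹) (𝓝 t) (𝓝 1) := by
      simpa using ha.tendsto.inv.const_mul (a t)
    have e2 : Tendsto (fun u => b u * (b t)⁻¹) (𝓝 t) (𝓝 1) := by
      simpa using hb.tendsto.mul_const (b t)⁻¹
    exact e1.prodMk_nhds e2
  have he : ∀ u, j (a t * (a u)⁻¹) * k (b u * (b t)⁻¹) = j (a t) * c u * (k (b t))⁻¹ := by
    intro u
    rw [h u]
    simp only [map_mul, map_inv]
    group
  have hev := hl.eventually hsr
  simp only [he] at hev
  have hs' : ContMDiffAt 𝓘(ℝ, ℝ) 𝓘(ℝ, Ep) ∞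
      (fun u => (s (j (a t) * c u * (k (b t))⁻¹))⁻¹ * a t) t := by
    rw [← h1] at hs
    exact (hs.comp t hd).inv.mul contMDiffAt_const
  have hr' : ContMDiffAt 𝓘(ℝ, ℝ) 𝓘(ℝ, Em) ∞
      (fun u => r (j (a t) * c u * (k (b t))⁻¹) * b t) t := by
    rw [← h1] at hr
    exact (hr.comp t hd).mul contMDiffAt_const
  refine ⟨hs'.congr_of_eventuallyEq ?_, hr'.congr_of_eventuallyEq ?_⟩
  · filter_upwards [hev] with u hu
    rw [hu.1]
    group
  · filter_upwards [hev] with u hu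
    rw [hu.2]
    group

/-- A smooth curve through the identity has a unique smooth factorization, by lifting through the
covering `(a, b) ↦ a⁻¹ b`. -/
theorem existsUnique_isFactorization [CompleteSpace E] [CompleteSpace Ep] [CompleteSpace Em]
    (hc : IsCompl 𝔤p 𝔤m) (hj : IsBanachLieSubgroup (E' := Ep) L j 𝔤p)
    (hk : IsBanachLieSubgroup (E' := Em) L k 𝔤m) (hG : ∀ g : G, ∃ a b, g = j a * k b)
    {c : ℝ → G} (hcs : ContMDiff 𝓘(ℝ, ℝ) 𝓘(ℝ, E) ∞ c) (hc0 : c 0 = 1) :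
    ∃! g : (ℝ → Gp) × (ℝ → Gm),
      IsFactorization (E' := Ep) (E'' := Em) j k c g.1 g.2 Set.univ := by
  obtain ⟨F, ⟨hF0, hF⟩, huniq⟩ := (isCoveringMap_factor hc hj hk hG).existsUnique_continuousMap_lifts
    ⟨c, hcs.continuous⟩ 0 1 (by simp [hc0])
  have hF' (u : ℝ) : c u = (j (F u).1)⁻¹ * k (F u).2 := (congrFun hF u).symm
  have hsm (u : ℝ) := contMDiffAt_of_factor hc hj hk hcs.contMDiffAt
    (continuous_fst.comp F.continuous).continuousAt (continuous_snd.comp F.continuous).continuousAt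
    hF' (t := u)
  refine ⟨(fun u => (F u).1, fun u => (F u).2), ⟨fun u _ => (hsm u).1.contMDiffWithinAt,
    fun u _ => (hsm u).2.contMDiffWithinAt, congrArg Prod.fst hF0, congrArg Prod.snd hF0,
    fun u _ => hF' u⟩, ?_⟩
  rintro ⟨a, b⟩ h
  have ha : Continuous a := (contMDiffOn_univ.1 h.smooth_p).continuous
  have hb : Continuous b := (contMDiffOn_univ.1 h.smooth_m).continuous
  have hu := huniq ⟨fun u => (a u, b u), ha.prodMk hb⟩
    ⟨Prod.ext h.zero_p h.zero_m, funext fun u => (h.factor u trivial).symm⟩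
  refine Prod.ext ?_ ?_ <;> ext u
  · exact congrArg Prod.fst (DFunLike.congr_fun hu u)
  · exact congrArg Prod.snd (DFunLike.congr_fun hu u)

end Factorization


/-! ### Factorization solves the Lax equation -/

section LaxFlow

open Filter Topology

variable {𝕜 𝔤 : Type*} [RCLike 𝕜] [NormedAddCommGroup 𝔤] [NormedSpace 𝕜 𝔤] [NormedSpace ℝ 𝔤]
  [IsScalarTower ℝ 𝕜 𝔤]
  {E : Type*} [NormedAddCommGroup E] [NormedSpace ℝ E] [CompleteSpace E]
  {G : Type*} [TopologicalSpace G] [ChartedSpace E G] [Group G] [LieGroup 𝓘(ℝ, E) ∞ G]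
  {Ep : Type*} [NormedAddCommGroup Ep] [NormedSpace ℝ Ep]
  {Gp : Type*} [TopologicalSpace Gp] [ChartedSpace Ep Gp] [Group Gp] [LieGroup 𝓘(ℝ, Ep) ∞ Gp]
  {Em : Type*} [NormedAddCommGroup Em] [NormedSpace ℝ Em]
  {Gm : Type*} [TopologicalSpace Gm] [ChartedSpace Em Gm] [Group Gm] [LieGroup 𝓘(ℝ, Em) ∞ Gm]
  {br : 𝔤 →L[𝕜] 𝔤 →L[𝕜] 𝔤} {B : 𝔤 →L[𝕜] 𝔤 →L[𝕜] 𝕜} {H : 𝔤 → 𝕜} {𝔤p 𝔤m : Submodule 𝕜 𝔤}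
  {L : GroupLieAlgebra 𝓘(ℝ, E) G ≃L[ℝ] 𝔤} {j : Gp →* G} {k : Gm →* G}

omit [NormedSpace ℝ 𝔤] [IsScalarTower ℝ 𝕜 𝔤] in
theorem IsLieSplitting.projP_eq (hs : IsLieSplitting br 𝔤p 𝔤m) {x a b : 𝔤} (ha : a ∈ 𝔤p)
    (hb : b ∈ 𝔤m) (h : x = a - b) : hs.projP x = a := by
  rw [IsLieSplitting.projP, h, map_sub, Submodule.projection_apply_of_mem_left _ ha,
    (Submodule.projection_apply_eq_zero_iff _).2 hb, sub_zero]

/-- For a factorization `exp (-t ∇_{x₀} H) = g₊(t)⁻¹ g₋(t)`, the curve `x(t) = Ad_{g₊(t)} x₀`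
satisfies `x' = [(∇_x H)₊, x]`: the logarithmic derivatives of `g₋ = g₊ exp (-t ∇_{x₀} H)` satisfy
`g₋' g₋⁻¹ = g₊' g₊⁻¹ - Ad_{g₊} ∇_{x₀} H`, and `Ad_{g₊} ∇_{x₀} H = ∇_x H` by equivariance of the
gradient, so `g₊' g₊⁻¹ = (∇_x H)₊`. -/
theorem IsFactorization.hasDerivAt_adjointCLM (hB : IsDualityPairing B)
    (hinv : IsInvariantPairing br B) (hs : IsLieSplitting br 𝔤p 𝔤m) (hL : IsLieAlgebraIso br L)
    (hj : IsBanachLieSubgroup (E' := Ep) L j 𝔤p) (hk : IsBanachLieSubgroup (E' := Em) L k 𝔤m)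
    (hH : H ∈ admissible B) (hAd : ∀ (g : G) x, H (adjoint L g x) = H x) {x₀ : 𝔤} {c : ℝ → G}
    (hc : IsExpCurve L (-grad B H x₀) c) {J : Set ℝ} (hJ : IsOpen J) (hJc : J.OrdConnected)
    (h0 : 0 ∈ J) {gp : ℝ → Gp} {gm : ℝ → Gm}
    (hf : IsFactorization (E' := Ep) (E'' := Em) j k c gp gm J) {t : ℝ} (ht : t ∈ J) :
    HasDerivAt (fun s => adjointCLM L (j (gp s)) x₀)
      (br (hs.projP (grad B H (adjointCLM L (j (gp t)) x₀))) (adjointCLM L (j (gp t)) x₀)) t := by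
  have hp (s : ℝ) (hs : s ∈ J) :=
    hj.hasRightLogDerivAt_comp ((hf.smooth_p s hs).contMDiffAt (hJ.mem_nhds hs))
  have hm (s : ℝ) (hs : s ∈ J) :=
    hk.hasRightLogDerivAt_comp ((hf.smooth_m s hs).contMDiffAt (hJ.mem_nhds hs))
  obtain ⟨ξ, hξ, hξ'⟩ := hp t ht
  obtain ⟨η, hη, hη'⟩ := hm t ht
  have hpair : ∀ x y, B (adjointCLM L (j (gp t)) x) (adjointCLM L (j (gp t)) y) = B x y :=
    pairing_adjointCLM_eq (γ := fun s => j (gp s)) hL hinv hJ hJc h0 (by simp [hf.zero_p])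
      (fun s hs => (hp s hs).imp fun _ h => h.2) ht
  have hgrad := grad_adjointCLM hB hH (hAd (j (gp t))) hpair x₀
  have hprod := (hξ'.mul (hc.hasRightLogDerivAt t)).congr (γ' := fun s => k (gm s)) (by
    filter_upwards [hJ.mem_nhds ht] with s hs
    rw [hf.factor s hs, mul_inv_cancel_left])
  have h1 := congrArg (modelEquiv L) (hη'.unique hprod)
  rw [map_add, ← adjointCLM_apply, map_neg, ← hgrad] at h1
  have h2 := hs.projP_eq (x := grad B H (adjointCLM L (j (gp t)) x₀)) hξ hη (by rw [h1]; abel)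
  rw [h2]
  exact hξ'.hasDerivAt_adjoint hL x₀

omit [IsScalarTower ℝ 𝕜 𝔤] [LieGroup 𝓘(ℝ, Ep) ∞ Gp] [LieGroup 𝓘(ℝ, Em) ∞ Gm] in
/-- `Ad_{g₊(t)} x₀ = Ad_{g₋(t)} x₀`, because `x₀` commutes with its gradient. -/
theorem IsFactorization.adjointCLM_eq (hbr : IsLieBracket br) (hL : IsLieAlgebraIso br L)
    {x₀ X : 𝔤} (hX : br x₀ X = 0) {c : ℝ → G} (hc : IsExpCurve L (-X) c) {J : Set ℝ}
    {gp : ℝ → Gp} {gm : ℝ → Gm} (hf : IsFactorization (E' := Ep) (E'' := Em) j k c gp gm J)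
    {t : ℝ} (ht : t ∈ J) : adjointCLM L (j (gp t)) x₀ = adjointCLM L (k (gm t)) x₀ := by
  have h1 : br (-X) x₀ = 0 := by
    rw [map_neg, neg_apply, ← hbr.skew, hX]
  have h2 : k (gm t) = j (gp t) * c t := by rw [hf.factor t ht, mul_inv_cancel_left]
  rw [h2, adjointCLM_mul, hc.adjointCLM_eq hL h1]

end LaxFlow

end BanachAKS

theorem mainTheorem4
    {𝕜 : Type*} [RCLike 𝕜]
    {𝔤 : Type*} [NormedAddCommGroup 𝔤] [NormedSpace 𝕜 𝔤] [NormedSpace ℝ 𝔤] [IsScalarTower ℝ 𝕜 𝔤]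
    [CompleteSpace 𝔤]
    (br : 𝔤 →L[𝕜] 𝔤 →L[𝕜] 𝔤) (hbr : IsLieBracket br)
    (B : 𝔤 →L[𝕜] 𝔤 →L[𝕜] 𝕜) (hB : IsDualityPairing B) (hinv : IsInvariantPairing br B)
    (R : 𝔤 →L[𝕜] 𝔤) (hR : IsClassicalRMatrix br R) (hRdual : DualPreservesRange B R) :
    -- the Lie–Poisson structure of the `R`-bracket
    (IsBanachLiePoissonSpace B (rBracket br R) ∧
      IsSkewBiderivation (admissible B) (liePoisson B (rBracket br R)) ∧
      ((∀ x y, B x y = B y x) →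
        IsGeneralizedBanachPoisson B (liePoissonTensor B (rBracket br R)) ∧
        IsPoissonBracketOn (smoothAdmissible B) (liePoisson B (rBracket br R)))) ∧
    -- (1)
    (∀ F ∈ admissible B, ∀ G ∈ admissible B, IsAdInvariantFun br F → IsAdInvariantFun br G →
      liePoisson B (rBracket br R) F G = 0) ∧
    -- (2)
    (∀ F ∈ admissible B, IsAdInvariantFun br F → ∀ X : 𝔤 → 𝔤,
      (IsHamiltonianVectorField B (rBracket br R) F X ↔
        ∀ x, X x = (2⁻¹ : 𝕜) • br (R (grad B F x)) x) ∧
      (IsHamiltonianVectorField B (rBracket br R) F X → ∀ (J : Set ℝ) (γ : ℝ → 𝔤),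
        (IsIntegralCurveOn γ (fun _ => X) J ↔
          ∀ t ∈ J, HasDerivWithinAt γ ((2⁻¹ : 𝕜) • br (R (grad B F (γ t))) (γ t)) J t))) ∧
    -- (2') and (3)
    (∀ (𝔤p 𝔤m : Submodule 𝕜 𝔤) (hs : IsLieSplitting br 𝔤p 𝔤m),
      (∀ x, R x = hs.projP x - hs.projM x) →
      (∀ F ∈ admissible B, IsAdInvariantFun br F → ∀ X : 𝔤 → 𝔤,
        IsHamiltonianVectorField B (rBracket br R) F X →
          ∀ x, X x = br (hs.projP (grad B F x)) x ∧ X x = -br (hs.projM (grad B F x)) x) ∧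
      (∀ {E : Type*} [NormedAddCommGroup E] [NormedSpace ℝ E] [CompleteSpace E]
        {G : Type*} [TopologicalSpace G] [ChartedSpace E G] [Group G] [LieGroup 𝓘(ℝ, E) ∞ G]
        {Ep : Type*} [NormedAddCommGroup Ep] [NormedSpace ℝ Ep] [CompleteSpace Ep]
        {Gp : Type*} [TopologicalSpace Gp] [ChartedSpace Ep Gp] [Group Gp]
        [LieGroup 𝓘(ℝ, Ep) ∞ Gp]
        {Em : Type*} [NormedAddCommGroup Em] [NormedSpace ℝ Em] [CompleteSpace Em]
        {Gm : Type*} [TopologicalSpace Gm] [ChartedSpace Em Gm] [Group Gm]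
        [LieGroup 𝓘(ℝ, Em) ∞ Gm]
        (L : GroupLieAlgebra 𝓘(ℝ, E) G ≃L[ℝ] 𝔤) (j : Gp →* G) (k : Gm →* G),
        IsLieAlgebraIso br L →
        IsBanachLieSubgroup (E' := Ep) L j 𝔤p → IsBanachLieSubgroup (E' := Em) L k 𝔤m →
        (∀ g : G, ∃ a b, g = j a * k b) →
        ∀ H ∈ admissible B, (∀ g x, H (adjoint L g x) = H x) →
          IsAdInvariantFun br H ∧
          ∀ X : 𝔤 → 𝔤, IsHamiltonianVectorField B (rBracket br R) H X →
          ∀ (x₀ : 𝔤) (c : ℝ → G), IsExpCurve L (-grad B H x₀) c →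
            (∃! g : (ℝ → Gp) × (ℝ → Gm),
              IsFactorization (E' := Ep) (E'' := Em) j k c g.1 g.2 Set.univ) ∧
            ∀ J : Set ℝ, IsOpen J → J.OrdConnected → 0 ∈ J →
              ∀ (gp : ℝ → Gp) (gm : ℝ → Gm),
                IsFactorization (E' := Ep) (E'' := Em) j k c gp gm J →
                (∀ t ∈ J, adjoint L (j (gp t)) x₀ = adjoint L (k (gm t)) x₀) ∧
                adjoint L (j (gp 0)) x₀ = x₀ ∧
                IsIntegralCurveOn (fun t => adjoint L (j (gp t)) x₀) (fun _ => X) J ∧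
                (H ∈ smoothAdmissible B → ∀ y : ℝ → 𝔤,
                  IsIntegralCurveOn y (fun _ => X) J → y 0 = x₀ →
                    ∀ t ∈ J, y t = adjoint L (j (gp t)) x₀))) := by
  refine ⟨⟨isBanachLiePoissonSpace_rBracket hB hinv hR hRdual,
      isSkewBiderivation_admissible hB hR, fun hsymm => ?_⟩,
    fun F hF G hG hFi hGi => liePoisson_rBracket_eq_zero hbr hinv hB hF hG hFi hGi, ?_, ?_⟩
  · obtain ⟨A, hA⟩ := exists_coadjoint hB hinv hRdual
    exact ⟨isGeneralizedBanachPoisson_liePoissonTensor hB hsymm hR hA,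
      isPoissonBracketOn_smoothAdmissible hB hsymm hR hA⟩
  · intro F hF hFi X
    have h := isHamiltonianVectorField_iff (R := R) hbr hinv hB hF hFi X
    refine ⟨h, fun hX J γ => ?_⟩
    simp only [IsIntegralCurveOn, h.1 hX]
  · intro 𝔤p 𝔤m hs hRs
    have hX' : ∀ F ∈ admissible B, IsAdInvariantFun br F → ∀ X : 𝔤 → 𝔤,
        IsHamiltonianVectorField B (rBracket br R) F X →
          ∀ x, X x = br (hs.projP (grad B F x)) x ∧ X x = -br (hs.projM (grad B F x)) x := by
      intro F hF hFi X hX x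
      rw [(isHamiltonianVectorField_iff hbr hinv hB hF hFi X).1 hX x]
      exact half_br_splitting hbr hs hRs (hFi.br_grad hbr hB hinv hF x)
    refine ⟨hX', ?_⟩
    intro E _ _ _ G _ _ _ _ Ep _ _ _ Gp _ _ _ _ Em _ _ _ Gm _ _ _ _ L j k hL hj hk hG H hH hAd
    have hHi := isAdInvariantFun_of_adjoint_invariant hL hH hAd
    refine ⟨hHi, fun X hX x₀ c hc => ⟨existsUnique_isFactorization hs.isCompl hj hk hG hc.smooth
      hc.map_zero, fun J hJ hJc h0 gp gm hf => ?_⟩⟩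
    have h0' : adjoint L (j (gp 0)) x₀ = x₀ := by
      rw [hf.zero_p, map_one, adjoint_eq_adjointCLM, adjointCLM_one]
    have hint : IsIntegralCurveOn (fun t => adjoint L (j (gp t)) x₀) (fun _ => X) J := by
      intro t ht
      exact ((hf.hasDerivAt_adjointCLM hB hinv hs hL hj hk hH hAd hc hJ hJc h0 ht).congr_deriv
        (hX' H hH hHi X hX _).1.symm).hasDerivWithinAt
    refine ⟨fun t ht => hf.adjointCLM_eq hbr hL (hHi.br_grad hbr hB hinv hH x₀) hc ht, h0', hint,
      fun hHs y hy hy0 => ?_⟩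
    -- the gradient of `H` is smooth, hence so is its Hamiltonian vector field
    have hXs : ContDiff 𝕜 1 X := by
      rw [funext ((isHamiltonianVectorField_iff hbr hinv hB hH hHi X).1 hX)]
      exact (((br.contDiff.comp (R.contDiff.comp hHs.2)).clm_apply contDiff_id).const_smul _).of_le
        ENat.LEInfty.out
    exact eqOn_of_isIntegralCurveOn (hXs.restrict_scalars ℝ) hJ hJc h0 hy hint (hy0.trans h0'.symm)
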